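/- Let $\Omega\subset\mathbb R^2$ be a non-empty, bounded, open, convex set. Let $w(\Omega)$ be its width, that is, the minimal distance between two parallel lines supporting $\Omega$ from opposite sides, and let $\mathrm{diam}(\Omega)=\sup\{|x-y|:x,y\in\Omega\}$. Let $H_0^1(\Omega)$ be the closure of $C_c^\infty(\Omega)$ in $H^1(\Omega)$, let $$\lambda(\Omega)=\inf_{\varphi\in H_0^1(\Omega)\setminus\{0\}}\frac{\int_\Omega|D\varphi|^2}{\int_\Omega\varphi^2}$$ be the bottom of the spectrum of the Dirichlet Laplacian on $\Omega$, and let $v_\Omega$ be the torsion function of $\Omega$, that is, the unique weak solution $v\in H_0^1(\Omega)$ of $-\Delta v=1$ in $\Omega$. Then $v_\Omega$ exists, is essentially bounded on $\Omega$, and $$\|v_\Omega\|_{L^\infty(\Omega)}\,\lambda(\Omega)\le\frac{\pi^2}{8}\left(1+7\cdot 3^{2/3}\left(\frac{w(\Omega)}{\mathrm{diam}(\Omega)}\right)^{2/3}\right).$$ -/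

import Mathlib

open MeasureTheory Filter Topology
open scoped ENNReal ContDiff

noncomputable section

/-- The Euclidean plane. -/
abbrev Plane : Type := EuclideanSpace ℝ (Fin 2)

/-- `φ` belongs to `C_c^∞(Ω)`. -/
structure IsTestFunction (Ω : Set Plane) (φ : Plane → ℝ) : Prop where
  smooth : ContDiff ℝ ∞ φ
  compact : HasCompactSupport φ
  support_subset : tsupport φ ⊆ Ω

/-- `u` belongs to `H_0^1(Ω)`, the closure of `C_c^∞(Ω)` in the `H^1` norm, and `g` is its weak
gradient `Du`: some sequence of test functions converges to `u` in `L^2(Ω)` while its gradients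
converge to `g` in `L^2(Ω; ℝ²)`. Values outside `Ω` are irrelevant. -/
structure IsH10WithGradient (Ω : Set Plane) (u : Plane → ℝ) (g : Plane → Plane) : Prop where
  memLp : MemLp u 2 (volume.restrict Ω)
  memLp_grad : MemLp g 2 (volume.restrict Ω)
  approx : ∃ φ : ℕ → Plane → ℝ, (∀ n, IsTestFunction Ω (φ n)) ∧
    Tendsto (fun n => eLpNorm (fun x => φ n x - u x) 2 (volume.restrict Ω)) atTop (𝓝 0) ∧
    Tendsto (fun n => eLpNorm (fun x => gradient (φ n) x - g x) 2 (volume.restrict Ω))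
      atTop (𝓝 0)

/-- `v` is (a representative of) the torsion function of `Ω`: `v ∈ H_0^1(Ω)` and `-Δ v = 1`
weakly in `Ω`. -/
def IsTorsionFunction (Ω : Set Plane) (v : Plane → ℝ) : Prop :=
  ∃ g : Plane → Plane, IsH10WithGradient Ω v g ∧
    ∀ φ : Plane → ℝ, IsTestFunction Ω φ →
      ∫ x in Ω, inner ℝ (g x) (gradient φ x) = ∫ x in Ω, φ x

/-- The bottom of the spectrum of the Dirichlet Laplacian of a nonempty open set `Ω`: the infimum of
the Rayleigh quotients of the nonzero elements of `H_0^1(Ω)`. -/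
def dirichletBottom (Ω : Set Plane) : ℝ :=
  sInf {r : ℝ | ∃ (u : Plane → ℝ) (g : Plane → Plane), IsH10WithGradient Ω u g ∧
    ¬ (u =ᵐ[volume.restrict Ω] 0) ∧
    r = (∫ x in Ω, ‖g x‖ ^ 2) / ∫ x in Ω, u x ^ 2}

/-- The width of a nonempty bounded set `Ω`: the minimum, over unit normals `ν`, of the distance
between the two lines with normal `ν` that support `Ω` from opposite sides. -/
def planarWidth (Ω : Set Plane) : ℝ :=
  ⨅ ν : Metric.sphere (0 : Plane) 1,
    (sSup ((fun x : Plane => inner ℝ (ν : Plane) x) '' Ω) -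
      sInf ((fun x : Plane => inner ℝ (ν : Plane) x) '' Ω))

end

/-! The two factors are bounded separately, in terms of the width `w` and the diameter `d`.

Torsion: if the set lies in a strip of width `W`, the strip's own torsion function, a parabola
across it with maximum `W² / 8`, is a supersolution, so weak comparison gives `0 ≤ v ≤ W² / 8`.
Letting `W` decrease to `w` bounds the norm by `w² / 8`. Existence is Lax–Milgram with the Poincaré
inequality.

Eigenvalue: the claim is `λ w² ≤ π² (1 + 14 τ)` with `τ = (w / d)^(2/3)`; domain monotonicity
reduces it to inscribing a rectangle. Across a nearly minimal strip there is a chord of length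
almost `w` (`exists_chord`), and some point of the set lies at distance almost `√(d² - w²) / 2` or
more from that chord. The triangle they span contains, for each `0 < s < 1`, a rectangle with sides
about `s √(d² - w²) / 2` and `(1 - s) w`. Its two contributions to `λ w² / π²` exceed `1` by about
`4 (w / d)² / s²` and `2 s`, which balance at `s = τ`. When `τ` is not small, the inradius bound `w
/ 3` (`exists_ball_subset`) suffices.

Finally `14 = 7 · 2` and `2 ≤ 3^(2/3)`. -/

/-! ### A smooth substitute for the positive part -/

/-- The primitive of `Real.smoothTransition`. -/
noncomputable def smoothPosPart (t : ℝ) : ℝ := ∫ r in (0 : ℝ)..t, Real.smoothTransition r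

theorem hasDerivAt_smoothPosPart (t : ℝ) :
    HasDerivAt smoothPosPart (Real.smoothTransition t) t :=
  intervalIntegral.integral_hasDerivAt_right
    (Real.smoothTransition.continuous.intervalIntegrable _ _)
    (Real.smoothTransition.continuous.stronglyMeasurableAtFilter _ _)
    Real.smoothTransition.continuous.continuousAt

theorem contDiff_smoothPosPart : ContDiff ℝ ∞ smoothPosPart := by
  rw [contDiff_infty_iff_deriv]
  refine ⟨fun t => (hasDerivAt_smoothPosPart t).differentiableAt, ?_⟩
  have : deriv smoothPosPart = Real.smoothTransition :=
    funext fun t => (hasDerivAt_smoothPosPart t).deriv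
  rw [this]
  exact Real.smoothTransition.contDiff

theorem smoothPosPart_of_nonpos {t : ℝ} (ht : t ≤ 0) : smoothPosPart t = 0 := by
  have : ∫ r in (0 : ℝ)..t, Real.smoothTransition r = ∫ _ in (0 : ℝ)..t, (0 : ℝ) := by
    refine intervalIntegral.integral_congr fun r hr => ?_
    rw [Set.uIcc_of_ge ht] at hr
    exact Real.smoothTransition.zero_of_nonpos hr.2
  simpa [smoothPosPart] using this

theorem monotone_smoothPosPart : Monotone smoothPosPart :=
  monotone_of_deriv_nonneg (fun t => (hasDerivAt_smoothPosPart t).differentiableAt)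
    fun t => by
      rw [(hasDerivAt_smoothPosPart t).deriv]
      exact Real.smoothTransition.nonneg t

theorem smoothPosPart_nonneg (t : ℝ) : 0 ≤ smoothPosPart t := by
  rcases le_total t 0 with h | h
  · exact (smoothPosPart_of_nonpos h).ge
  · rw [← smoothPosPart_of_nonpos le_rfl]
    exact monotone_smoothPosPart h

theorem smoothPosPart_pos {t : ℝ} (ht : 0 < t) : 0 < smoothPosPart t :=
  intervalIntegral.intervalIntegral_pos_of_pos_on
    (Real.smoothTransition.continuous.intervalIntegrable _ _)
    (fun _ hr => Real.smoothTransition.pos_of_pos hr.1) ht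

theorem abs_smoothPosPart_sub_le (s t : ℝ) :
    |smoothPosPart s - smoothPosPart t| ≤ |s - t| := by
  have := Convex.norm_image_sub_le_of_norm_deriv_le (f := smoothPosPart) (C := 1)
    (s := Set.univ) (x := t) (y := s)
    (fun x _ => (hasDerivAt_smoothPosPart x).differentiableAt)
    (fun x _ => by
      rw [(hasDerivAt_smoothPosPart x).deriv, Real.norm_of_nonneg (Real.smoothTransition.nonneg x)]
      exact Real.smoothTransition.le_one x) convex_univ trivial trivial
  simpa using this

/-- After rescaling by `δ` the loss `1` becomes `δ`, so the cosine bumps below converge to the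
cosine. -/
theorem sub_one_le_smoothPosPart (t : ℝ) : t - 1 ≤ smoothPosPart t := by
  rcases le_total t 1 with h | h
  · linarith [smoothPosPart_nonneg t]
  · have hint := fun a b : ℝ =>
      Real.smoothTransition.continuous.intervalIntegrable (μ := volume) a b
    have h1 : ∫ r in (1 : ℝ)..t, Real.smoothTransition r = ∫ _ in (1 : ℝ)..t, (1 : ℝ) := by
      refine intervalIntegral.integral_congr fun r hr => ?_
      rw [Set.uIcc_of_le h] at hr
      exact Real.smoothTransition.one_of_one_le hr.1
    have h2 := smoothPosPart_nonneg 1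
    rw [smoothPosPart] at h2 ⊢
    rw [← intervalIntegral.integral_add_adjacent_intervals (hint 0 1) (hint 1 t), h1]
    simpa using h2

/-! ### Test functions -/

namespace IsTestFunction

variable {Ω : Set Plane} {φ : Plane → ℝ}

theorem apply_eq_zero (h : IsTestFunction Ω φ) {x : Plane} (hx : x ∉ Ω) : φ x = 0 :=
  image_eq_zero_of_notMem_tsupport fun hx' => hx (h.support_subset hx')

theorem fderiv_eq_zero (h : IsTestFunction Ω φ) {x : Plane} (hx : x ∉ Ω) : fderiv ℝ φ x = 0 :=
  fderiv_of_notMem_tsupport ℝ fun hx' => hx (h.support_subset hx')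

theorem differentiable (h : IsTestFunction Ω φ) : Differentiable ℝ φ :=
  h.smooth.differentiable (by simp)

theorem continuous (h : IsTestFunction Ω φ) : Continuous φ := h.smooth.continuous

theorem continuous_fderiv (h : IsTestFunction Ω φ) : Continuous (fderiv ℝ φ) :=
  h.smooth.continuous_fderiv (by simp)

theorem continuous_gradient (h : IsTestFunction Ω φ) : Continuous (gradient φ) :=
  (InnerProductSpace.toDual ℝ Plane).symm.continuous.comp h.continuous_fderiv

theorem hasCompactSupport_gradient (h : IsTestFunction Ω φ) : HasCompactSupport (gradient φ) :=
  (h.compact.fderiv ℝ).comp_left (g := (InnerProductSpace.toDual ℝ Plane).symm) (map_zero _)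

theorem memLp (h : IsTestFunction Ω φ) (p : ℝ≥0∞) (μ : Measure Plane)
    [IsFiniteMeasureOnCompacts μ] : MemLp φ p μ :=
  h.continuous.memLp_of_hasCompactSupport h.compact

theorem memLp_gradient (h : IsTestFunction Ω φ) (p : ℝ≥0∞) (μ : Measure Plane)
    [IsFiniteMeasureOnCompacts μ] : MemLp (gradient φ) p μ :=
  h.continuous_gradient.memLp_of_hasCompactSupport h.hasCompactSupport_gradient

theorem pow_two (h : IsTestFunction Ω φ) : IsTestFunction Ω fun x => φ x ^ 2 where
  smooth := h.smooth.pow 2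
  compact := h.compact.comp_left (g := fun t : ℝ => t ^ 2) (by simp)
  support_subset := (closure_mono fun x hx => by
    simp only [Function.mem_support, ne_eq] at hx ⊢
    exact fun h0 => hx (by simp [h0])).trans h.support_subset

theorem add {ψ : Plane → ℝ} (hφ : IsTestFunction Ω φ) (hψ : IsTestFunction Ω ψ) :
    IsTestFunction Ω fun x => φ x + ψ x where
  smooth := hφ.smooth.add hψ.smooth
  compact := hφ.compact.add hψ.compact
  support_subset := (tsupport_add φ ψ).trans
    (Set.union_subset hφ.support_subset hψ.support_subset)

theorem const_mul (c : ℝ) (hφ : IsTestFunction Ω φ) : IsTestFunction Ω fun x => c * φ x where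
  smooth := contDiff_const.mul hφ.smooth
  compact := hφ.compact.mul_left
  support_subset := (closure_mono fun x hx => by
    simp only [Function.mem_support, ne_eq] at hx ⊢
    exact fun h0 => hx (by simp [h0])).trans hφ.support_subset

/-- Both integrands vanish off `Ω`, so this is integration by parts on the whole plane, with no
boundary term and no regularity of `∂Ω`. -/
theorem integral_mul_fderiv (h : IsTestFunction Ω φ) {f : Plane → ℝ} (hf : ContDiff ℝ ∞ f)
    (v : Plane) :
    ∫ x in Ω, f x * fderiv ℝ φ x v = -∫ x in Ω, fderiv ℝ f x v * φ x := by
  rw [setIntegral_eq_integral_of_forall_compl_eq_zero,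
    setIntegral_eq_integral_of_forall_compl_eq_zero]
  · have hf' : Continuous fun x => fderiv ℝ f x v :=
      (hf.continuous_fderiv (by simp)).clm_apply continuous_const
    have hφ' : Continuous fun x => fderiv ℝ φ x v :=
      h.continuous_fderiv.clm_apply continuous_const
    refine integral_mul_fderiv_eq_neg_fderiv_mul_of_integrable ?_ ?_ ?_
      (fun x _ => (hf.differentiable (by simp)) x) (fun x _ => h.differentiable x)
    · exact (hf'.mul h.continuous).integrable_of_hasCompactSupport h.compact.mul_left
    · exact (hf.continuous.mul hφ').integrable_of_hasCompactSupport
        (h.compact.fderiv_apply ℝ v).mul_left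
    · exact (hf.continuous.mul h.continuous).integrable_of_hasCompactSupport h.compact.mul_left
  · intro x hx
    simp [h.apply_eq_zero hx]
  · intro x hx
    simp [h.fderiv_eq_zero hx]

end IsTestFunction

theorem abs_fderiv_apply_le_norm_gradient (φ : Plane → ℝ) (x v : Plane) :
    |fderiv ℝ φ x v| ≤ ‖gradient φ x‖ * ‖v‖ := by
  rw [← inner_gradient_left]
  exact abs_real_inner_le_norm _ _

/-- The Poincaré inequality. -/
theorem exists_integral_sq_le_integral_gradient_sq {Ω : Set Plane} (hΩ : IsOpen Ω)
    (hbdd : Bornology.IsBounded Ω) :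
    ∃ C : ℝ, 0 ≤ C ∧ ∀ φ, IsTestFunction Ω φ →
      ∫ x in Ω, φ x ^ 2 ≤ C * ∫ x in Ω, ‖gradient φ x‖ ^ 2 := by
  obtain ⟨R, hR⟩ := hbdd.exists_norm_le
  -- Integrate `φ²` against `∂ₑ⟨e, x⟩ = 1` by parts. As `|⟨e, x⟩| ≤ R`, Young's inequality leaves
  -- `φ² / 2`, which is absorbed, plus `2 R² |∇φ|²`.
  refine ⟨4 * R ^ 2, by positivity, fun φ h => ?_⟩
  set e : Plane := EuclideanSpace.single 0 1 with he
  have hee : ‖e‖ = 1 := by simp [he]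
  have hf : ∀ x, fderiv ℝ (fun x : Plane => inner ℝ e x) x e = 1 := fun x => by
    have : HasFDerivAt (fun x : Plane => inner ℝ e x) (innerSL ℝ e) x :=
      (innerSL ℝ e).hasFDerivAt
    rw [this.fderiv]
    simp [hee]
  have key := h.pow_two.integral_mul_fderiv (f := fun x : Plane => inner ℝ e x)
    (innerSL ℝ e).contDiff e
  have hd : ∀ x, fderiv ℝ (fun x => φ x ^ 2) x e = 2 * φ x * fderiv ℝ φ x e := fun x => by
    rw [((h.differentiable x).hasFDerivAt.pow 2).fderiv]
    simp
  simp only [hf, hd, one_mul] at key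
  have i1 : Integrable (fun x => φ x ^ 2) (volume.restrict Ω) :=
    (h.memLp 2 _).integrable_sq
  have i2 : Integrable (fun x => ‖gradient φ x‖ ^ 2) (volume.restrict Ω) :=
    (h.memLp_gradient 2 _).norm.integrable_sq
  have i3 : Integrable (fun x => inner ℝ e x * (2 * φ x * fderiv ℝ φ x e))
      (volume.restrict Ω) := by
    refine Continuous.integrable_of_hasCompactSupport ?_ (h.compact.mul_left.mul_right.mul_left)
    have := h.continuous_fderiv.clm_apply (continuous_const (y := e))
    have := h.continuous
    fun_prop
  have : ∫ x in Ω, φ x ^ 2 ≤ ∫ x in Ω, (1 / 2 * φ x ^ 2 + 2 * R ^ 2 * ‖gradient φ x‖ ^ 2) := by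
    rw [← neg_eq_iff_eq_neg.mpr key, ← integral_neg]
    refine setIntegral_mono_on i3.neg ((i1.const_mul _).add (i2.const_mul _))
      hΩ.measurableSet fun x hx => ?_
    have h1 : |inner ℝ e x| ≤ R :=
      (abs_real_inner_le_norm e x).trans (by rw [hee, one_mul]; exact hR x hx)
    have h2 := abs_fderiv_apply_le_norm_gradient φ x e
    rw [hee, mul_one] at h2
    have h3 : |inner ℝ e x * fderiv ℝ φ x e| ≤ R * ‖gradient φ x‖ := by
      rw [abs_mul]
      exact mul_le_mul h1 h2 (abs_nonneg _) ((abs_nonneg _).trans h1)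
    have h4 := sq_le_sq' (neg_le_of_abs_le h3) (le_of_abs_le h3)
    nlinarith [sq_nonneg (φ x + 2 * (inner ℝ e x * fderiv ℝ φ x e))]
  rw [integral_add (i1.const_mul _) (i2.const_mul _), integral_const_mul, integral_const_mul]
    at this
  linarith

/-! ### Square integrals and the `L²` norm -/

theorem MeasureTheory.MemLp.integral_norm_sq_eq {α E : Type*} [MeasurableSpace α] {μ : Measure α}
    [NormedAddCommGroup E] {f : α → E} (hf : MemLp f 2 μ) :
    ∫ x, ‖f x‖ ^ 2 ∂μ = (eLpNorm f 2 μ).toReal ^ 2 := by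
  have h0 : 0 ≤ ∫ x, ‖f x‖ ^ 2 ∂μ := integral_nonneg fun x => by positivity
  rw [hf.eLpNorm_eq_integral_rpow_norm (by simp) (by simp)]
  simp only [ENNReal.toReal_ofNat, Real.rpow_ofNat]
  rw [ENNReal.toReal_ofReal (by positivity), ← Real.rpow_natCast, ← Real.rpow_mul h0]
  norm_num

theorem tendsto_integral_norm_sq_of_tendsto_eLpNorm {α E : Type*} [MeasurableSpace α]
    {μ : Measure α} [NormedAddCommGroup E] {f : ℕ → α → E} (hf : ∀ n, MemLp (f n) 2 μ)
    (h : Tendsto (fun n => eLpNorm (f n) 2 μ) atTop (𝓝 0)) :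
    Tendsto (fun n => ∫ x, ‖f n x‖ ^ 2 ∂μ) atTop (𝓝 0) := by
  simp only [(hf _).integral_norm_sq_eq]
  have := ((ENNReal.tendsto_toReal ENNReal.zero_ne_top).comp h).pow 2
  simpa using this

theorem integrable_inner_of_memLp {α E : Type*} [MeasurableSpace α] {μ : Measure α}
    [NormedAddCommGroup E] [InnerProductSpace ℝ E] {f g : α → E} (hf : MemLp f 2 μ)
    (hg : MemLp g 2 μ) : Integrable (fun x => inner ℝ (f x) (g x)) μ :=
  (hf.norm.integrable_mul hg.norm).mono' (hf.aestronglyMeasurable.inner hg.aestronglyMeasurable)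
    (ae_of_all _ fun _ => norm_inner_le_norm _ _)

/-! ### The weak maximum principle -/

section Truncation

variable {Ω : Set Plane} {φ ψ : Plane → ℝ}

/-- The smooth substitute for `(φ - ψ)⁺`, cut off to `Ω`. -/
noncomputable def smoothTruncation (Ω : Set Plane) (φ ψ : Plane → ℝ) : Plane → ℝ :=
  Ω.indicator fun x => smoothPosPart (φ x - ψ x)

/-- Where `φ` vanishes locally, the argument is `-ψ ≤ 0` inside `Ω`, and the indicator kills what is
outside. This makes the cutoff smooth across `∂Ω`. -/
theorem smoothTruncation_eventuallyEq_zero (hψ : ∀ x ∈ Ω, 0 ≤ ψ x)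
    {x : Plane} (hx : x ∉ tsupport φ) : smoothTruncation Ω φ ψ =ᶠ[𝓝 x] 0 := by
  filter_upwards [notMem_tsupport_iff_eventuallyEq.mp hx] with y hy
  by_cases hyΩ : y ∈ Ω
  · rw [smoothTruncation, Set.indicator_of_mem hyΩ]
    exact smoothPosPart_of_nonpos (by simpa [hy] using hψ y hyΩ)
  · exact Set.indicator_of_notMem hyΩ _

theorem smoothTruncation_eventuallyEq (hΩ : IsOpen Ω) {x : Plane} (hx : x ∈ Ω) :
    smoothTruncation Ω φ ψ =ᶠ[𝓝 x] fun x => smoothPosPart (φ x - ψ x) := by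
  filter_upwards [hΩ.mem_nhds hx] with y hy
  exact Set.indicator_of_mem hy _

theorem isTestFunction_smoothTruncation (hΩ : IsOpen Ω) (hφ : IsTestFunction Ω φ)
    (hψ : ContDiff ℝ ∞ ψ) (hψ0 : ∀ x ∈ Ω, 0 ≤ ψ x) :
    IsTestFunction Ω (smoothTruncation Ω φ ψ) := by
  have hsupp : tsupport (smoothTruncation Ω φ ψ) ⊆ tsupport φ := fun x hx => by
    by_contra h
    exact (notMem_tsupport_iff_eventuallyEq.mpr (smoothTruncation_eventuallyEq_zero hψ0 h)) hx
  refine ⟨contDiff_iff_contDiffAt.mpr fun x => ?_, ?_, hsupp.trans hφ.support_subset⟩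
  · by_cases hx : x ∈ Ω
    · exact (contDiff_smoothPosPart.comp (hφ.smooth.sub hψ)).contDiffAt.congr_of_eventuallyEq
        (smoothTruncation_eventuallyEq hΩ hx)
    · exact contDiffAt_const.congr_of_eventuallyEq
        (smoothTruncation_eventuallyEq_zero hψ0 fun h => hx (hφ.support_subset h))
  · exact hφ.compact.of_isClosed_subset (isClosed_tsupport _) hsupp

theorem gradient_smoothTruncation (hΩ : IsOpen Ω) (hφ : IsTestFunction Ω φ)
    (hψ : ContDiff ℝ ∞ ψ) {x : Plane} (hx : x ∈ Ω) :
    gradient (smoothTruncation Ω φ ψ) x =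
      Real.smoothTransition (φ x - ψ x) • (gradient φ x - gradient ψ x) := by
  rw [(smoothTruncation_eventuallyEq hΩ hx).gradient_eq]
  have h := (hasDerivAt_smoothPosPart (φ x - ψ x)).comp_hasFDerivAt x
    ((hφ.differentiable x).hasFDerivAt.sub ((hψ.differentiable (by simp)) x).hasFDerivAt)
  rw [gradient, show (fun x => smoothPosPart (φ x - ψ x)) = smoothPosPart ∘ fun x => φ x - ψ x
    from rfl]
  erw [h.fderiv]
  simp [gradient]

end Truncation

theorem ContDiff.memLp_gradient_restrict {Ω : Set Plane} {ψ : Plane → ℝ} (hψ : ContDiff ℝ ∞ ψ)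
    (hbdd : Bornology.IsBounded Ω) (p : ℝ≥0∞) : MemLp (gradient ψ) p (volume.restrict Ω) := by
  have hc : Continuous (gradient ψ) :=
    (InnerProductSpace.toDual ℝ Plane).symm.continuous.comp (hψ.continuous_fderiv (by simp))
  have hK : IsCompact (closure Ω) := hbdd.isCompact_closure
  obtain ⟨C, hC⟩ := hK.exists_bound_of_continuousOn hc.continuousOn
  have : IsFiniteMeasure (volume.restrict (closure Ω)) :=
    isFiniteMeasure_restrict.mpr hK.measure_lt_top.ne
  exact (MemLp.of_bound hc.aestronglyMeasurable C
    ((ae_restrict_iff' hK.measurableSet).mpr (ae_of_all _ hC))).mono_measure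
      (Measure.restrict_mono subset_closure le_rfl)

theorem ContDiff.memLp_restrict {Ω : Set Plane} {ψ : Plane → ℝ} (hψ : ContDiff ℝ ∞ ψ)
    (hbdd : Bornology.IsBounded Ω) (p : ℝ≥0∞) : MemLp ψ p (volume.restrict Ω) := by
  have hK : IsCompact (closure Ω) := hbdd.isCompact_closure
  obtain ⟨C, hC⟩ := hK.exists_bound_of_continuousOn hψ.continuous.continuousOn
  have : IsFiniteMeasure (volume.restrict (closure Ω)) :=
    isFiniteMeasure_restrict.mpr hK.measure_lt_top.ne
  exact (MemLp.of_bound hψ.continuous.aestronglyMeasurable C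
    ((ae_restrict_iff' hK.measurableSet).mpr (ae_of_all _ hC))).mono_measure
      (Measure.restrict_mono subset_closure le_rfl)

/-- The weak comparison principle: an element of `H_0^1(Ω)` lies below any smooth function that is
nonnegative on `Ω` and whose Laplacian is weakly smaller. -/
theorem IsH10WithGradient.ae_le_of_forall_integral_inner_le {Ω : Set Plane} (hΩ : IsOpen Ω)
    (hbdd : Bornology.IsBounded Ω) {u : Plane → ℝ} {g : Plane → Plane}
    (hu : IsH10WithGradient Ω u g) {ψ : Plane → ℝ} (hψ : ContDiff ℝ ∞ ψ)
    (hψ0 : ∀ x ∈ Ω, 0 ≤ ψ x)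
    (hsub : ∀ φ, IsTestFunction Ω φ → (∀ x, 0 ≤ φ x) →
      ∫ x in Ω, inner ℝ (g x) (gradient φ x) ≤ ∫ x in Ω, inner ℝ (gradient ψ x) (gradient φ x)) :
    ∀ᵐ x ∂volume.restrict Ω, u x ≤ ψ x := by
  obtain ⟨φ, hφ, hφu, hφg⟩ := hu.approx
  obtain ⟨C, hC0, hC⟩ := exists_integral_sq_le_integral_gradient_sq hΩ hbdd
  set μ := volume.restrict Ω with hμ
  have hmu : ∀ n, MemLp (fun x => φ n x - u x) 2 μ := fun n => ((hφ n).memLp 2 _).sub hu.memLp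
  have hmg : ∀ n, MemLp (fun x => gradient (φ n) x - g x) 2 μ := fun n =>
    ((hφ n).memLp_gradient 2 _).sub hu.memLp_grad
  have hθ := fun n => isTestFunction_smoothTruncation hΩ (hφ n) hψ hψ0
  have hψg : MemLp (gradient ψ) 2 μ := hψ.memLp_gradient_restrict hbdd 2
  -- Pointwise, with `p = ∇φₙ - ∇ψ`, `q = g - ∇ψ` and `τ ∈ [0, 1]`, one has `|p - q|² + 2⟨q, τp⟩ -
  -- |τp|² = |(1 - τ)p - q|² + 2τ(1 - τ)|p|² ≥ 0`. The cross term integrates to something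
  -- nonpositive by `hsub`.
  have energy : ∀ n, ∫ x in Ω, ‖gradient (smoothTruncation Ω (φ n) ψ) x‖ ^ 2 ≤
      ∫ x in Ω, ‖gradient (φ n) x - g x‖ ^ 2 := fun n => by
    have hθg := (hθ n).memLp_gradient 2 μ
    have i1 : Integrable (fun x => inner ℝ (g x) (gradient (smoothTruncation Ω (φ n) ψ) x)) μ :=
      integrable_inner_of_memLp hu.memLp_grad hθg
    have i2 : Integrable
        (fun x => inner ℝ (gradient ψ x) (gradient (smoothTruncation Ω (φ n) ψ) x)) μ :=
      integrable_inner_of_memLp hψg hθg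
    have h1 := hsub _ (hθ n) fun x => Set.indicator_nonneg (fun _ _ => smoothPosPart_nonneg _) x
    have i3 : Integrable (fun x => ‖gradient (φ n) x - g x‖ ^ 2) μ :=
      (hmg n).norm.integrable_sq
    have i4 : Integrable (fun x => inner ℝ (g x) (gradient (smoothTruncation Ω (φ n) ψ) x)
        - inner ℝ (gradient ψ x) (gradient (smoothTruncation Ω (φ n) ψ) x)) μ := i1.sub i2
    calc ∫ x in Ω, ‖gradient (smoothTruncation Ω (φ n) ψ) x‖ ^ 2
        ≤ ∫ x in Ω, (‖gradient (φ n) x - g x‖ ^ 2 +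
            2 * (inner ℝ (g x) (gradient (smoothTruncation Ω (φ n) ψ) x)
              - inner ℝ (gradient ψ x) (gradient (smoothTruncation Ω (φ n) ψ) x))) := by
          refine setIntegral_mono_on hθg.norm.integrable_sq (i3.add (i4.const_mul 2))
            hΩ.measurableSet fun x hx => ?_
          rw [gradient_smoothTruncation hΩ (hφ n) hψ hx]
          have ht0 := Real.smoothTransition.nonneg (φ n x - ψ x)
          have ht1 := Real.smoothTransition.le_one (φ n x - ψ x)
          generalize Real.smoothTransition (φ n x - ψ x) = τ at ht0 ht1
          generalize gradient (φ n) x = a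
          generalize gradient ψ x = b
          generalize g x = c
          have e1 : a - c = (a - b) - (c - b) := by abel
          rw [e1, ← inner_sub_left]
          generalize a - b = p
          generalize c - b = q
          rw [norm_smul, mul_pow, Real.norm_of_nonneg ht0, real_inner_smul_right,
            norm_sub_sq_real]
          have e2 : 0 ≤ ‖(1 - τ) • p - q‖ ^ 2 := by positivity
          rw [norm_sub_sq_real, norm_smul, mul_pow, real_inner_smul_left,
            Real.norm_of_nonneg (sub_nonneg.mpr ht1)] at e2
          rw [real_inner_comm p q]
          have e3 : 0 ≤ τ * (1 - τ) * ‖p‖ ^ 2 :=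
            mul_nonneg (mul_nonneg ht0 (sub_nonneg.mpr ht1)) (by positivity)
          nlinarith
      _ ≤ _ := by
          rw [integral_add i3 (i4.const_mul 2), integral_const_mul, integral_sub i1 i2]
          linarith
  have hlim : Tendsto (fun n => 2 * (C * ∫ x in Ω, ‖gradient (φ n) x - g x‖ ^ 2) +
      2 * ∫ x in Ω, ‖φ n x - u x‖ ^ 2) atTop (𝓝 0) := by
    have a1 := tendsto_integral_norm_sq_of_tendsto_eLpNorm hmg hφg
    have a2 := tendsto_integral_norm_sq_of_tendsto_eLpNorm hmu hφu
    simpa using ((a1.const_mul C).const_mul 2).add (a2.const_mul 2)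
  have hηm : AEStronglyMeasurable (fun x => smoothPosPart (u x - ψ x)) μ :=
    contDiff_smoothPosPart.continuous.comp_aestronglyMeasurable
      (hu.memLp.aestronglyMeasurable.sub hψ.continuous.aestronglyMeasurable)
  have hη2 : MemLp (fun x => smoothPosPart (u x - ψ x)) 2 μ := by
    refine (hu.memLp.sub (hψ.memLp_restrict hbdd 2)).mono hηm (ae_of_all _ fun x => ?_)
    simpa [smoothPosPart_of_nonpos le_rfl] using abs_smoothPosPart_sub_le (u x - ψ x) 0
  -- The truncation of `φₙ - ψ` is controlled by Poincaré and `energy`; passing from `φₙ` to `u`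
  -- costs `|φₙ - u|`, since `smoothPosPart` is 1-Lipschitz. Both errors tend to zero.
  have hle : ∀ n, ∫ x in Ω, smoothPosPart (u x - ψ x) ^ 2 ≤
      2 * (C * ∫ x in Ω, ‖gradient (φ n) x - g x‖ ^ 2) + 2 * ∫ x in Ω, ‖φ n x - u x‖ ^ 2 :=
      fun n => by
    have j1 : Integrable (fun x => smoothTruncation Ω (φ n) ψ x ^ 2) μ :=
      ((hθ n).memLp 2 μ).integrable_sq
    have j2 : Integrable (fun x => ‖φ n x - u x‖ ^ 2) μ := (hmu n).norm.integrable_sq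
    have : ∫ x in Ω, smoothPosPart (u x - ψ x) ^ 2 ≤
        ∫ x in Ω, (2 * smoothTruncation Ω (φ n) ψ x ^ 2 + 2 * ‖φ n x - u x‖ ^ 2) := by
      refine setIntegral_mono_on hη2.integrable_sq ((j1.const_mul 2).add (j2.const_mul 2))
        hΩ.measurableSet fun x hx => ?_
      rw [smoothTruncation, Set.indicator_of_mem hx, Real.norm_eq_abs, sq_abs]
      have h1 := sq_le_sq.mpr (abs_smoothPosPart_sub_le (u x - ψ x) (φ n x - ψ x))
      nlinarith [sq_nonneg (smoothPosPart (u x - ψ x) - 2 * smoothPosPart (φ n x - ψ x))]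
    rw [integral_add (j1.const_mul 2) (j2.const_mul 2), integral_const_mul,
      integral_const_mul] at this
    have h2 := (hC _ (hθ n)).trans (mul_le_mul_of_nonneg_left (energy n) hC0)
    linarith
  have hzero : ∫ x in Ω, smoothPosPart (u x - ψ x) ^ 2 = 0 :=
    le_antisymm (ge_of_tendsto' hlim hle) (integral_nonneg fun x => by positivity)
  rw [integral_eq_zero_iff_of_nonneg (fun x => by positivity) hη2.integrable_sq] at hzero
  filter_upwards [hzero] with x hx
  by_contra! h
  have := smoothPosPart_pos (sub_pos.mpr h)
  simp only [Pi.zero_apply] at hx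
  exact this.ne' (pow_eq_zero_iff two_ne_zero |>.mp hx)

theorem IsH10WithGradient.neg {Ω : Set Plane} {u : Plane → ℝ} {g : Plane → Plane}
    (hu : IsH10WithGradient Ω u g) : IsH10WithGradient Ω (fun x => -u x) fun x => -g x := by
  obtain ⟨φ, hφ, hφu, hφg⟩ := hu.approx
  refine ⟨hu.memLp.neg, hu.memLp_grad.neg, fun n x => -1 * φ n x, fun n => (hφ n).const_mul _,
    ?_, ?_⟩
  · refine hφu.congr fun n => ?_
    rw [← eLpNorm_neg]
    congr 1
    ext x
    simp
    ring
  · refine hφg.congr fun n => ?_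
    rw [← eLpNorm_neg]
    congr 1
    ext1 x
    have : gradient (fun x => -1 * φ n x) x = -gradient (φ n) x := by
      simp [gradient]
    rw [this]
    simp [sub_eq_add_neg, add_comm]

/-- The torsion function of a bounded open set contained in a strip of width `W` takes values in
`[0, W² / 8]`. -/
theorem IsTorsionFunction.ae_mem_Icc {Ω : Set Plane} (hΩ : IsOpen Ω)
    (hbdd : Bornology.IsBounded Ω) {v : Plane → ℝ} (hv : IsTorsionFunction Ω v) {ν : Plane}
    (hν : ‖ν‖ = 1) {m W : ℝ} (hstrip : ∀ x ∈ Ω, m ≤ inner ℝ ν x ∧ inner ℝ ν x ≤ m + W) :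
    ∀ᵐ x ∂volume.restrict Ω, v x ∈ Set.Icc 0 (W ^ 2 / 8) := by
  obtain ⟨g, hg, hw⟩ := hv
  -- The torsion function of the strip: it vanishes on both lines, satisfies `-Δψ = 1`, and peaks at
  -- `W² / 8` midway.
  set ψ : Plane → ℝ := fun x => (inner ℝ ν x - m) * (m + W - inner ℝ ν x) / 2 with hψdef
  have hl : ContDiff ℝ ∞ fun x : Plane => inner ℝ ν x := (innerSL ℝ ν).contDiff
  have hψ : ContDiff ℝ ∞ ψ := ((hl.sub contDiff_const).mul (contDiff_const.sub hl)).div_const _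
  have hψg : ∀ x, gradient ψ x = (m + W / 2 - inner ℝ ν x) • ν := fun x => by
    have h1 : HasFDerivAt (fun x : Plane => inner ℝ ν x) (innerSL ℝ ν) x :=
      (innerSL ℝ ν).hasFDerivAt
    have h2 := ((h1.sub_const m).mul (h1.const_sub (m + W))).mul_const (1 / 2)
    have h3 : fderiv ℝ ψ x = _ := HasFDerivAt.fderiv (by simpa [hψdef, div_eq_mul_inv] using h2)
    apply ext_inner_right ℝ
    intro y
    rw [inner_gradient_left, h3, real_inner_smul_left]
    simp
    ring
  have hψw : ∀ φ, IsTestFunction Ω φ →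
      ∫ x in Ω, inner ℝ (gradient ψ x) (gradient φ x) = ∫ x in Ω, φ x := fun φ hφ => by
    have h1 := hφ.integral_mul_fderiv (f := fun x => m + W / 2 - inner ℝ ν x)
      (contDiff_const.sub hl) ν
    have h2 : ∀ x, fderiv ℝ (fun x : Plane => m + W / 2 - inner ℝ ν x) x ν = -1 := fun x => by
      have h1 : HasFDerivAt (fun x : Plane => inner ℝ ν x) (innerSL ℝ ν) x :=
        (innerSL ℝ ν).hasFDerivAt
      rw [(h1.const_sub _).fderiv]
      simp [hν]
    simp only [h2, neg_one_mul, integral_neg, neg_neg] at h1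
    rw [← h1]
    congr 1
    ext x
    rw [hψg, real_inner_smul_left, real_inner_comm (gradient φ x) ν,
      inner_gradient_left]
  have hup := hg.ae_le_of_forall_integral_inner_le hΩ hbdd hψ
    (fun x hx => by
      obtain ⟨h1, h2⟩ := hstrip x hx
      exact div_nonneg (mul_nonneg (by linarith) (by linarith)) zero_le_two)
    (fun φ hφ _ => by rw [hw φ hφ, hψw φ hφ])
  -- The lower bound is the same comparison, of `-v` with `0`.
  have hlow := hg.neg.ae_le_of_forall_integral_inner_le hΩ hbdd (ψ := fun _ => 0)
    contDiff_const (fun _ _ => le_rfl)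
    (fun φ hφ h0 => by
      simp only [inner_neg_left, integral_neg, hw φ hφ]
      have : 0 ≤ ∫ x in Ω, φ x := integral_nonneg h0
      simpa [gradient] using this)
  filter_upwards [hup, hlow] with x h1 h2
  refine ⟨by linarith, h1.trans ?_⟩
  simp only [hψdef]
  nlinarith [sq_nonneg (inner ℝ ν x - m - W / 2)]

/-! ### Existence of the torsion function -/

/-- The Hilbert space `L²(Ω) × L²(Ω; ℝ²)`. -/
abbrev FunctionGradientSpace (Ω : Set Plane) : Type :=
  WithLp 2 (Lp ℝ 2 (volume.restrict Ω) × Lp Plane 2 (volume.restrict Ω))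

/-- The pairs `(φ, Dφ)` with `φ` a test function. -/
noncomputable def testPairs (Ω : Set Plane) : Submodule ℝ (FunctionGradientSpace Ω) where
  carrier := {p | ∃ φ, IsTestFunction Ω φ ∧ p.fst =ᵐ[volume.restrict Ω] φ ∧
    p.snd =ᵐ[volume.restrict Ω] gradient φ}
  add_mem' := by
    rintro p q ⟨φ, hφ, h1, h2⟩ ⟨ψ, hψ, h3, h4⟩
    refine ⟨_, hφ.add hψ, ?_, ?_⟩
    · rw [WithLp.add_fst]
      filter_upwards [Lp.coeFn_add p.fst q.fst, h1, h3] with x a b c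
      rw [a, Pi.add_apply, b, c]
    · rw [WithLp.add_snd]
      filter_upwards [Lp.coeFn_add p.snd q.snd, h2, h4] with x a b c
      rw [a, Pi.add_apply, b, c, gradient, gradient, gradient, ← map_add]
      congr 1
      exact (fderiv_add (hφ.differentiable x) (hψ.differentiable x)).symm
  zero_mem' := by
    refine ⟨fun _ => 0, ⟨contDiff_const, HasCompactSupport.zero, by simp [tsupport]⟩, ?_, ?_⟩
    · exact Lp.coeFn_zero _ _ _
    · filter_upwards [Lp.coeFn_zero Plane 2 (volume.restrict Ω)] with x a
      rw [WithLp.zero_snd, a]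
      simp [gradient]
  smul_mem' := by
    rintro c p ⟨φ, hφ, h1, h2⟩
    refine ⟨_, hφ.const_mul c, ?_, ?_⟩
    · rw [WithLp.smul_fst]
      filter_upwards [Lp.coeFn_smul c p.fst, h1] with x a b
      simp [a, b]
    · rw [WithLp.smul_snd]
      filter_upwards [Lp.coeFn_smul c p.snd, h2] with x a b
      rw [a, Pi.smul_apply, b, gradient, gradient, fderiv_const_mul (hφ.differentiable x)]
      simp

/-- The Poincaré inequality is a closed condition on pairs, so it survives the closure; this yields
coercivity. -/
theorem norm_fst_sq_le_of_mem_closure_testPairs {Ω : Set Plane} {C : ℝ}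
    (hC : ∀ φ, IsTestFunction Ω φ →
      ∫ x in Ω, φ x ^ 2 ≤ C * ∫ x in Ω, ‖gradient φ x‖ ^ 2)
    {p : FunctionGradientSpace Ω} (hp : p ∈ (testPairs Ω).topologicalClosure) :
    ‖p.fst‖ ^ 2 ≤ C * ‖p.snd‖ ^ 2 := by
  have hclosed : IsClosed {p : FunctionGradientSpace Ω | ‖p.fst‖ ^ 2 ≤ C * ‖p.snd‖ ^ 2} :=
    isClosed_le (by fun_prop) (by fun_prop)
  refine closure_minimal ?_ hclosed hp
  rintro p ⟨φ, hφ, h1, h2⟩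
  have e1 : ‖p.fst‖ ^ 2 = ∫ x in Ω, φ x ^ 2 := by
    rw [Lp.norm_def, eLpNorm_congr_ae h1, ← (hφ.memLp 2 _).integral_norm_sq_eq]
    simp
  have e2 : ‖p.snd‖ ^ 2 = ∫ x in Ω, ‖gradient φ x‖ ^ 2 := by
    rw [Lp.norm_def, eLpNorm_congr_ae h2, ← (hφ.memLp_gradient 2 _).integral_norm_sq_eq]
  simpa only [Set.mem_ofPred_eq, e1, e2] using hC φ hφ

theorem isH10WithGradient_of_mem_closure_testPairs {Ω : Set Plane}
    {p : FunctionGradientSpace Ω} (hp : p ∈ (testPairs Ω).topologicalClosure) :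
    IsH10WithGradient Ω p.fst p.snd := by
  obtain ⟨q, hq, hlim⟩ := mem_closure_iff_seq_limit.mp hp
  choose φ hφ h1 h2 using hq
  refine ⟨Lp.memLp _, Lp.memLp _, φ, hφ, ?_, ?_⟩
  · have hf : Tendsto (fun n => (q n).fst) atTop (𝓝 p.fst) :=
      ((WithLp.continuous_fst _ _ _).tendsto p).comp hlim
    refine ((Lp.tendsto_Lp_iff_tendsto_eLpNorm' _ _).mp hf).congr fun n => ?_
    refine eLpNorm_congr_ae ?_
    filter_upwards [h1 n] with x hx
    simp [hx]
  · have hf : Tendsto (fun n => (q n).snd) atTop (𝓝 p.snd) :=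
      ((WithLp.continuous_snd _ _ _).tendsto p).comp hlim
    refine ((Lp.tendsto_Lp_iff_tendsto_eLpNorm' _ _).mp hf).congr fun n => ?_
    refine eLpNorm_congr_ae ?_
    filter_upwards [h2 n] with x hx
    simp [hx]

/-- Lax–Milgram on the closure of `testPairs`, with the form pairing gradients. The functional `φ ↦
∫ φ` is continuous because `1 ∈ L²(Ω)` on a bounded set. -/
theorem exists_isTorsionFunction {Ω : Set Plane} (hΩ : IsOpen Ω)
    (hbdd : Bornology.IsBounded Ω) : ∃ v : Plane → ℝ, IsTorsionFunction Ω v := by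
  obtain ⟨C, hC0, hC⟩ := exists_integral_sq_le_integral_gradient_sq hΩ hbdd
  have hfin : IsFiniteMeasure (volume.restrict Ω) :=
    isFiniteMeasure_restrict.mpr hbdd.measure_lt_top.ne
  set K := (testPairs Ω).topologicalClosure with hK
  have : CompleteSpace K := (testPairs Ω).isClosed_topologicalClosure.completeSpace_coe
  let grad : K →L[ℝ] Lp Plane 2 (volume.restrict Ω) :=
    (WithLp.sndL 2 ℝ _ _).comp K.subtypeL
  let fn : K →L[ℝ] Lp ℝ 2 (volume.restrict Ω) := (WithLp.fstL 2 ℝ _ _).comp K.subtypeL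
  let B : K →L[ℝ] K →L[ℝ] ℝ := (innerSL ℝ).bilinearComp grad grad
  have hB : ∀ p q : K, B p q = inner ℝ (p : FunctionGradientSpace Ω).snd
    (q : FunctionGradientSpace Ω).snd := fun p q => rfl
  have hcoer : IsCoercive B := by
    refine ⟨(C + 1)⁻¹, by positivity, fun p => ?_⟩
    have h1 := norm_fst_sq_le_of_mem_closure_testPairs hC p.2
    have h2 : ‖p‖ ^ 2 = ‖(p : FunctionGradientSpace Ω).fst‖ ^ 2
        + ‖(p : FunctionGradientSpace Ω).snd‖ ^ 2 := WithLp.prod_norm_sq_eq_of_L2 _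
    rw [hB, real_inner_self_eq_norm_sq, mul_assoc, ← pow_two, h2, inv_mul_le_iff₀ (by positivity)]
    linarith
  let one : Lp ℝ 2 (volume.restrict Ω) := (memLp_const (1 : ℝ)).toLp _
  let ℓ : K →L[ℝ] ℝ := (innerSL ℝ one).comp fn
  let r : K := (InnerProductSpace.toDual ℝ K).symm ℓ
  let p : K := hcoer.continuousLinearEquivOfBilin.symm r
  refine ⟨_, _, isH10WithGradient_of_mem_closure_testPairs p.2, fun φ hφ => ?_⟩
  let y : K := ⟨WithLp.toLp 2 ((hφ.memLp 2 _).toLp φ, (hφ.memLp_gradient 2 _).toLp (gradient φ)),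
    subset_closure ⟨φ, hφ, MemLp.coeFn_toLp (hφ.memLp 2 _), MemLp.coeFn_toLp (hφ.memLp_gradient 2 _)⟩⟩
  have key : B p y = ℓ y := by
    rw [← hcoer.continuousLinearEquivOfBilin_apply, ContinuousLinearEquiv.apply_symm_apply,
      InnerProductSpace.toDual_symm_apply]
  have h1 : B p y = ∫ x in Ω, inner ℝ ((p : FunctionGradientSpace Ω).snd x) (gradient φ x) := by
    rw [hB, L2.inner_def]
    refine integral_congr_ae ?_
    filter_upwards [MemLp.coeFn_toLp (hφ.memLp_gradient 2 (volume.restrict Ω))] with x hx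
    simp only [y, WithLp.toLp_snd, hx]
  have h2 : ℓ y = ∫ x in Ω, φ x := by
    change inner ℝ one ((hφ.memLp 2 (volume.restrict Ω)).toLp φ) = _
    rw [L2.inner_def]
    refine integral_congr_ae ?_
    filter_upwards [MemLp.coeFn_toLp (hφ.memLp 2 (volume.restrict Ω)),
      MemLp.coeFn_toLp (memLp_const (p := 2) (μ := volume.restrict Ω) (1 : ℝ))] with x hx h1x
    simp only [one, hx, h1x]
    simp
  rw [← h1, ← h2, key]

/-! ### Upper bounds for the bottom of the spectrum -/

theorem dirichletBottom_nonneg (Ω : Set Plane) : 0 ≤ dirichletBottom Ω := by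
  refine Real.sInf_nonneg ?_
  rintro r ⟨u, g, -, -, rfl⟩
  exact div_nonneg (integral_nonneg fun x => by positivity) (integral_nonneg fun x => by positivity)

theorem dirichletBottom_le_of_isTestFunction {Ω : Set Plane} {φ : Plane → ℝ}
    (hφ : IsTestFunction Ω φ) (h0 : 0 < ∫ x in Ω, φ x ^ 2) :
    dirichletBottom Ω ≤ (∫ x in Ω, ‖gradient φ x‖ ^ 2) / ∫ x in Ω, φ x ^ 2 := by
  refine csInf_le ⟨0, ?_⟩ ⟨φ, gradient φ, ⟨hφ.memLp 2 _, hφ.memLp_gradient 2 _,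
    fun _ => φ, fun _ => hφ, by simp, by simp⟩, fun h => ?_, rfl⟩
  · rintro r ⟨u, g, -, -, rfl⟩
    exact div_nonneg (integral_nonneg fun x => by positivity)
      (integral_nonneg fun x => by positivity)
  · refine h0.ne' ?_
    have : ∫ x in Ω, φ x ^ 2 = ∫ x in Ω, (0 : ℝ) :=
      integral_congr_ae (h.mono fun x hx => by simp [hx])
    simpa using this

/-! ### One-dimensional cosine trial functions -/

/-- A smooth approximation of `cos (k x)` on `|x| < π / (2 k)`, extended by zero. -/
noncomputable def smoothCosBump (k δ x : ℝ) : ℝ :=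
  if |x| < Real.pi / (2 * k) then δ * smoothPosPart ((Real.cos (k * x) - δ) / δ) else 0

section SmoothCosBump

variable {k δ : ℝ}

/-- Near the endpoints the cosine is below `δ`, so the bump is already zero there and the `if`
creates no singularity. -/
theorem smoothCosBump_eventuallyEq_zero (hk : 0 < k) (hδ : 0 < δ) {x : ℝ}
    (hx : Real.pi / (2 * k) ≤ |x|) : smoothCosBump k δ =ᶠ[𝓝 x] 0 := by
  rcases hx.lt_or_eq with h | h
  · have : ∀ᶠ y in 𝓝 x, Real.pi / (2 * k) < |y| := continuous_abs.continuousAt.eventually_const_lt h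
    filter_upwards [this] with y hy
    exact if_neg hy.not_gt
  · have hc : Real.cos (k * x) < δ := by
      rw [← Real.cos_abs, abs_mul, abs_of_pos hk, ← h,
        show k * (Real.pi / (2 * k)) = Real.pi / 2 by field_simp, Real.cos_pi_div_two]
      exact hδ
    have : ∀ᶠ y in 𝓝 x, Real.cos (k * y) < δ :=
      (show Continuous fun y => Real.cos (k * y) by fun_prop).continuousAt.eventually_lt_const hc
    filter_upwards [this] with y hy
    rw [smoothCosBump, smoothPosPart_of_nonpos
      (div_nonpos_of_nonpos_of_nonneg (by linarith) hδ.le)]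
    simp

theorem smoothCosBump_eventuallyEq {x : ℝ} (hx : |x| < Real.pi / (2 * k)) :
    smoothCosBump k δ =ᶠ[𝓝 x] fun y => δ * smoothPosPart ((Real.cos (k * y) - δ) / δ) := by
  filter_upwards [continuous_abs.continuousAt.eventually_lt_const hx] with y hy
  exact if_pos hy

theorem contDiff_smoothCosBump (hk : 0 < k) (hδ : 0 < δ) : ContDiff ℝ ∞ (smoothCosBump k δ) := by
  refine contDiff_iff_contDiffAt.mpr fun x => ?_
  rcases lt_or_ge |x| (Real.pi / (2 * k)) with hx | hx
  · refine ContDiff.contDiffAt ?_ |>.congr_of_eventuallyEq (smoothCosBump_eventuallyEq hx)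
    refine contDiff_const.mul (contDiff_smoothPosPart.comp ?_)
    exact ((Real.contDiff_cos.comp (contDiff_const.mul contDiff_id)).sub contDiff_const).div_const _
  · exact contDiffAt_const.congr_of_eventuallyEq (smoothCosBump_eventuallyEq_zero hk hδ hx)

theorem tsupport_smoothCosBump_subset (hk : 0 < k) (hδ : 0 < δ) :
    tsupport (smoothCosBump k δ) ⊆ Set.Ioo (-(Real.pi / (2 * k))) (Real.pi / (2 * k)) := by
  intro x hx
  rw [Set.mem_Ioo, ← abs_lt]
  by_contra! h
  exact notMem_tsupport_iff_eventuallyEq.mpr (smoothCosBump_eventuallyEq_zero hk hδ h) hx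

theorem deriv_smoothCosBump_sq_le (hδ : 0 < δ) {x : ℝ} (hx : |x| < Real.pi / (2 * k)) :
    deriv (smoothCosBump k δ) x ^ 2 ≤ k ^ 2 * Real.sin (k * x) ^ 2 := by
  have h1 : HasDerivAt (fun y => (Real.cos (k * y) - δ) / δ) (-Real.sin (k * x) * k / δ) x := by
    have := ((((hasDerivAt_id x).const_mul k).cos).sub_const δ).div_const δ
    simpa using this
  have h2 := ((hasDerivAt_smoothPosPart _).comp x h1).const_mul δ
  have h3 := (h2.congr_of_eventuallyEq (smoothCosBump_eventuallyEq hx)).deriv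
  rw [h3, show ∀ τ : ℝ, δ * (τ * (-Real.sin (k * x) * k / δ)) = -(τ * (k * Real.sin (k * x))) by
    intro τ; field_simp, neg_sq, mul_pow, mul_pow k]
  have h4 := pow_le_one₀ (n := 2)
    (Real.smoothTransition.nonneg ((Real.cos (k * x) - δ) / δ)) (Real.smoothTransition.le_one _)
  exact mul_le_of_le_one_left (by positivity) h4

/-- The bump is at least `cos - 2δ`. Squaring this costs at most `4δ` when `cos ≥ 2δ`; otherwise
`cos² ≤ 2δ` already. -/
theorem le_smoothCosBump_sq (hk : 0 < k) (hδ : 0 < δ) {x : ℝ} (hx : |x| < Real.pi / (2 * k)) :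
    Real.cos (k * x) ^ 2 - 4 * δ ≤ smoothCosBump k δ x ^ 2 := by
  rw [smoothCosBump, if_pos hx]
  have h1 := mul_le_mul_of_nonneg_left (sub_one_le_smoothPosPart ((Real.cos (k * x) - δ) / δ)) hδ.le
  rw [mul_sub, mul_div_cancel₀ _ hδ.ne'] at h1
  have h2 := mul_nonneg hδ.le (smoothPosPart_nonneg ((Real.cos (k * x) - δ) / δ))
  have h3 : 0 ≤ Real.cos (k * x) := by
    obtain ⟨h4, h5⟩ := abs_lt.mp hx
    have e : k * (Real.pi / (2 * k)) = Real.pi / 2 := by field_simp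
    refine Real.cos_nonneg_of_neg_pi_div_two_le_of_le ?_ ?_
    · nlinarith
    · nlinarith
  have h4 := Real.cos_le_one (k * x)
  generalize δ * smoothPosPart ((Real.cos (k * x) - δ) / δ) = y at *
  rcases le_total (Real.cos (k * x)) (2 * δ) with h | h
  · nlinarith [mul_nonneg h3 (sub_nonneg.mpr h)]
  · nlinarith [mul_nonneg (sub_nonneg.mpr h) (sub_nonneg.mpr h1)]

theorem integral_deriv_smoothCosBump_sq_le (hk : 0 < k) (hδ : 0 < δ) :
    ∫ x, deriv (smoothCosBump k δ) x ^ 2 ≤ k ^ 2 * (Real.pi / (2 * k)) := by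
  have hH : 0 < Real.pi / (2 * k) := by positivity
  set H := Real.pi / (2 * k) with hHdef
  have hkH : k * H = Real.pi / 2 := by rw [hHdef]; field_simp
  have hsupp : Function.support (fun x => deriv (smoothCosBump k δ) x ^ 2) ⊆ Set.Ioc (-H) H := by
    intro x hx
    by_contra h
    refine hx ?_
    have : deriv (smoothCosBump k δ) x = 0 := by
      by_contra h0
      exact h (Set.Ioo_subset_Ioc_self
        (tsupport_smoothCosBump_subset hk hδ (support_deriv_subset h0)))
    simp [this]
  rw [← intervalIntegral.integral_eq_integral_of_support_subset hsupp]
  have hc : Continuous (deriv (smoothCosBump k δ)) :=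
    (contDiff_smoothCosBump hk hδ).continuous_deriv (by simp)
  calc ∫ x in (-H)..H, deriv (smoothCosBump k δ) x ^ 2
      ≤ ∫ x in (-H)..H, k ^ 2 * Real.sin (k * x) ^ 2 := by
        refine intervalIntegral.integral_mono_on_of_le_Ioo (by linarith)
          ((hc.pow 2).intervalIntegrable _ _)
          ((show Continuous fun x => k ^ 2 * Real.sin (k * x) ^ 2 by fun_prop).intervalIntegrable
            _ _) fun x hx => deriv_smoothCosBump_sq_le hδ (abs_lt.mpr hx)
    _ = k ^ 2 * H := by
        rw [intervalIntegral.integral_const_mul,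
          intervalIntegral.integral_comp_mul_left (fun y => Real.sin y ^ 2) hk.ne', integral_sin_sq,
          mul_neg, hkH]
        simp
        field_simp
        exact Or.inl (by linarith)

theorem le_integral_smoothCosBump_sq (hk : 0 < k) (hδ : 0 < δ) :
    (1 - 8 * δ) * (Real.pi / (2 * k)) ≤ ∫ x, smoothCosBump k δ x ^ 2 := by
  have hH : 0 < Real.pi / (2 * k) := by positivity
  set H := Real.pi / (2 * k) with hHdef
  have hkH : k * H = Real.pi / 2 := by rw [hHdef]; field_simp
  have hsupp : Function.support (fun x => smoothCosBump k δ x ^ 2) ⊆ Set.Ioc (-H) H := by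
    intro x hx
    by_contra h
    refine hx ?_
    have : smoothCosBump k δ x = 0 := by
      by_contra h0
      exact h (Set.Ioo_subset_Ioc_self
        (tsupport_smoothCosBump_subset hk hδ (subset_tsupport _ h0)))
    simp [this]
  rw [← intervalIntegral.integral_eq_integral_of_support_subset hsupp]
  have hc := (contDiff_smoothCosBump hk hδ).continuous
  have hcos : Continuous fun x => Real.cos (k * x) ^ 2 := by fun_prop
  calc (1 - 8 * δ) * H = ∫ x in (-H)..H, (Real.cos (k * x) ^ 2 - 4 * δ) := by
        rw [intervalIntegral.integral_sub (hcos.intervalIntegrable _ _) (by simp),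
          intervalIntegral.integral_comp_mul_left (fun y => Real.cos y ^ 2) hk.ne', integral_cos_sq,
          mul_neg, hkH]
        simp
        field_simp
        linarith
    _ ≤ _ := by
        refine intervalIntegral.integral_mono_on_of_le_Ioo (by linarith)
          ((hcos.sub continuous_const).intervalIntegrable _ _)
          ((hc.pow 2).intervalIntegrable _ _) fun x hx => le_smoothCosBump_sq hk hδ (abs_lt.mpr hx)

end SmoothCosBump

/-- The Rayleigh quotient of an interval of length `a` is approximated on `C_c^∞`. -/
theorem exists_contDiff_integral_deriv_sq_le (α : ℝ) {a ε : ℝ} (ha : 0 < a) (hε : 0 < ε) :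
    ∃ f : ℝ → ℝ, ContDiff ℝ ∞ f ∧ tsupport f ⊆ Set.Ioo α (α + a) ∧ 0 < ∫ x, f x ^ 2 ∧
      ∫ x, deriv f x ^ 2 ≤ (Real.pi ^ 2 / a ^ 2 + ε) * ∫ x, f x ^ 2 := by
  have hk : 0 < Real.pi / a := by positivity
  set k := Real.pi / a with hkdef
  have hkH : Real.pi / (2 * k) = a / 2 := by rw [hkdef]; field_simp
  -- Chosen so that `(k² + ε)(1 - 8δ) = k²`, which matches the upper and lower integral bounds
  -- exactly.
  set δ := ε / (8 * (k ^ 2 + ε)) with hδdef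
  have hδ : 0 < δ := by positivity
  have h8 : 1 - 8 * δ = k ^ 2 / (k ^ 2 + ε) := by rw [hδdef]; field_simp; ring
  set c := α + a / 2 with hc
  have hlow := le_integral_smoothCosBump_sq hk hδ
  have hup := integral_deriv_smoothCosBump_sq_le hk hδ
  rw [hkH] at hlow hup
  rw [h8] at hlow
  have e1 : ∫ x, smoothCosBump k δ (x - c) ^ 2 = ∫ x, smoothCosBump k δ x ^ 2 :=
    integral_sub_right_eq_self (fun x => smoothCosBump k δ x ^ 2) c
  have e2 : ∫ x, deriv (fun x => smoothCosBump k δ (x - c)) x ^ 2 =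
      ∫ x, deriv (smoothCosBump k δ) x ^ 2 := by
    simp only [deriv_comp_sub_const]
    exact integral_sub_right_eq_self (fun x => deriv (smoothCosBump k δ) x ^ 2) c
  refine ⟨fun x => smoothCosBump k δ (x - c),
    (contDiff_smoothCosBump hk hδ).comp (contDiff_id.sub contDiff_const), ?_, ?_, ?_⟩
  · intro x hx
    have : x - c ∈ tsupport (smoothCosBump k δ) :=
      tsupport_comp_subset_preimage (smoothCosBump k δ) (f := fun x => x - c) (by fun_prop) hx
    have := tsupport_smoothCosBump_subset hk hδ this
    rw [hkH] at this
    exact ⟨by linarith [this.1], by linarith [this.2]⟩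
  · rw [e1]
    exact lt_of_lt_of_le (by positivity) hlow
  · rw [e1, e2, ← div_pow, ← hkdef]
    refine hup.trans (le_trans (le_of_eq ?_) (mul_le_mul_of_nonneg_left hlow (by positivity)))
    field_simp

/-! ### Product trial functions on rectangles -/

section Rectangle

variable {e ν : Plane}

theorem exists_orthonormalBasis_of_inner_eq_zero (he : ‖e‖ = 1) (hν : ‖ν‖ = 1)
    (heν : inner ℝ e ν = 0) : ∃ b : OrthonormalBasis (Fin 2) ℝ Plane, b 0 = e ∧ b 1 = ν := by
  have horth : Orthonormal ℝ ![e, ν] := by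
    refine ⟨fun i => ?_, fun i j hij => ?_⟩
    · fin_cases i
      · exact he
      · exact hν
    · fin_cases i <;> fin_cases j
      · exact absurd rfl hij
      · exact heν
      · exact (real_inner_comm e ν).trans heν
      · exact absurd rfl hij
  have hspan := horth.linearIndependent.span_eq_top_of_card_eq_finrank (by simp)
  exact ⟨OrthonormalBasis.mk horth hspan.ge, by simp, by simp⟩

/-- Fubini in a rotated frame: orthonormal coordinates preserve Lebesgue measure. -/
theorem integral_mul_comp_inner (he : ‖e‖ = 1) (hν : ‖ν‖ = 1) (heν : inner ℝ e ν = 0)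
    (F G : ℝ → ℝ) :
    ∫ x : Plane, F (inner ℝ e x) * G (inner ℝ ν x) = (∫ x, F x) * ∫ x, G x := by
  obtain ⟨b, rfl, rfl⟩ := exists_orthonormalBasis_of_inner_eq_zero he hν heν
  have h1 := b.measurePreserving_repr.integral_comp
    b.repr.toHomeomorph.measurableEmbedding (fun y : Plane => F (y 0) * G (y 1))
  have h2 := (EuclideanSpace.volume_preserving_symm_measurableEquiv_toLp (Fin 2)).integral_comp
    (MeasurableEquiv.measurableEmbedding _) (fun y : Fin 2 → ℝ => F (y 0) * G (y 1))
  have h3 := (volume_preserving_finTwoArrow ℝ).integral_comp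
    (MeasurableEquiv.measurableEmbedding _) (fun y : ℝ × ℝ => F y.1 * G y.2)
  rw [← integral_prod_mul]
  simp only [OrthonormalBasis.repr_apply_apply] at h1
  rw [h1]
  exact h2.trans h3

/-- Monotonicity of the bottom of the spectrum, applied to an inscribed rectangle. -/
theorem dirichletBottom_le_of_rectangle_subset {Ω : Set Plane} (hbdd : Bornology.IsBounded Ω)
    (he : ‖e‖ = 1) (hν : ‖ν‖ = 1) (heν : inner ℝ e ν = 0) {α β a b : ℝ} (ha : 0 < a) (hb : 0 < b)
    (hsub : ∀ x : Plane, inner ℝ e x ∈ Set.Ioo α (α + a) → inner ℝ ν x ∈ Set.Ioo β (β + b) →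
      x ∈ Ω) :
    dirichletBottom Ω ≤ Real.pi ^ 2 / a ^ 2 + Real.pi ^ 2 / b ^ 2 := by
  refine le_of_forall_pos_le_add fun ε hε => ?_
  obtain ⟨f, hf, hfs, hf0, hfR⟩ := exists_contDiff_integral_deriv_sq_le α ha (half_pos hε)
  obtain ⟨h, hh, hhs, hh0, hhR⟩ := exists_contDiff_integral_deriv_sq_le β hb (half_pos hε)
  set φ : Plane → ℝ := fun x => f (inner ℝ e x) * h (inner ℝ ν x) with hφdef
  have hle : ContDiff ℝ ∞ fun x : Plane => inner ℝ e x := (innerSL ℝ e).contDiff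
  have hlν : ContDiff ℝ ∞ fun x : Plane => inner ℝ ν x := (innerSL ℝ ν).contDiff
  have hsupp : tsupport φ ⊆ Ω := fun x hx => by
    refine hsub x (hfs ?_) (hhs ?_)
    · exact tsupport_comp_subset_preimage f hle.continuous (tsupport_mul_subset_left hx)
    · exact tsupport_comp_subset_preimage h hlν.continuous (tsupport_mul_subset_right hx)
  have hφ : IsTestFunction Ω φ := by
    refine ⟨(hf.comp hle).mul (hh.comp hlν), ?_, hsupp⟩
    exact Metric.isCompact_of_isClosed_isBounded (isClosed_tsupport _) (hbdd.subset hsupp)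
  have hgrad : ∀ x, ‖gradient φ x‖ ^ 2 =
      deriv f (inner ℝ e x) ^ 2 * h (inner ℝ ν x) ^ 2 +
        f (inner ℝ e x) ^ 2 * deriv h (inner ℝ ν x) ^ 2 := fun x => by
    have h1 : HasFDerivAt (fun x : Plane => inner ℝ e x) (innerSL ℝ e) x :=
      (innerSL ℝ e).hasFDerivAt
    have h2 : HasFDerivAt (fun x : Plane => inner ℝ ν x) (innerSL ℝ ν) x :=
      (innerSL ℝ ν).hasFDerivAt
    have h3 := ((hf.differentiable (by simp) (inner ℝ e x)).hasDerivAt).comp_hasFDerivAt x h1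
    have h4 := ((hh.differentiable (by simp) (inner ℝ ν x)).hasDerivAt).comp_hasFDerivAt x h2
    have h5 : fderiv ℝ φ x = _ := (h3.mul h4).fderiv
    have h6 : gradient φ x = (deriv f (inner ℝ e x) * h (inner ℝ ν x)) • e +
        (f (inner ℝ e x) * deriv h (inner ℝ ν x)) • ν := by
      apply ext_inner_right ℝ
      intro y
      rw [inner_gradient_left, h5, inner_add_left, real_inner_smul_left, real_inner_smul_left]
      simp
      ring
    rw [h6, norm_add_sq_real, norm_smul, norm_smul, he, hν, real_inner_smul_left,
      real_inner_smul_right, heν]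
    simp only [mul_one, mul_zero, add_zero, Real.norm_eq_abs, sq_abs, mul_pow]
  have hφ2 : ∫ x in Ω, φ x ^ 2 = (∫ x, f x ^ 2) * ∫ x, h x ^ 2 := by
    rw [setIntegral_eq_integral_of_forall_compl_eq_zero
      fun x hx => by rw [hφ.apply_eq_zero hx]; simp]
    rw [← integral_mul_comp_inner he hν heν]
    simp only [hφdef, mul_pow]
  have hg2 : ∫ x in Ω, ‖gradient φ x‖ ^ 2 =
      (∫ x, deriv f x ^ 2) * (∫ x, h x ^ 2) + (∫ x, f x ^ 2) * ∫ x, deriv h x ^ 2 := by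
    have hf' : ContDiff ℝ ∞ (deriv f) := (contDiff_infty_iff_deriv.mp hf).2
    have hh' : ContDiff ℝ ∞ (deriv h) := (contDiff_infty_iff_deriv.mp hh).2
    have i1 : Integrable (fun x : Plane => deriv f (inner ℝ e x) ^ 2 * h (inner ℝ ν x) ^ 2)
        (volume.restrict Ω) := memLp_one_iff_integrable.mp
      ((((hf'.comp hle).pow 2).mul ((hh.comp hlν).pow 2)).memLp_restrict hbdd 1)
    have i2 : Integrable (fun x : Plane => f (inner ℝ e x) ^ 2 * deriv h (inner ℝ ν x) ^ 2)
        (volume.restrict Ω) := memLp_one_iff_integrable.mp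
      ((((hf.comp hle).pow 2).mul ((hh'.comp hlν).pow 2)).memLp_restrict hbdd 1)
    -- Hence each term of the squared gradient vanishes off `Ω`, and its integral extends to the
    -- plane, where it factors.
    have hz : ∀ x ∉ Ω, inner ℝ e x ∉ tsupport f ∨ inner ℝ ν x ∉ tsupport h := fun x hx => by
      by_contra! hc
      exact hx (hsub x (hfs hc.1) (hhs hc.2))
    simp only [hgrad]
    rw [integral_add i1 i2, setIntegral_eq_integral_of_forall_compl_eq_zero,
      setIntegral_eq_integral_of_forall_compl_eq_zero,
      integral_mul_comp_inner he hν heν (fun t => deriv f t ^ 2) fun t => h t ^ 2,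
      integral_mul_comp_inner he hν heν (fun t => f t ^ 2) fun t => deriv h t ^ 2]
    · intro x hx
      rcases hz x hx with h0 | h0
      · rw [image_eq_zero_of_notMem_tsupport h0]
        simp
      · have : deriv h (inner ℝ ν x) = 0 := by
          by_contra h1
          exact h0 (support_deriv_subset h1)
        simp [this]
    · intro x hx
      rcases hz x hx with h0 | h0
      · have : deriv f (inner ℝ e x) = 0 := by
          by_contra h1
          exact h0 (support_deriv_subset h1)
        simp [this]
      · rw [image_eq_zero_of_notMem_tsupport h0]
        simp
  have hpos : 0 < ∫ x in Ω, φ x ^ 2 := by rw [hφ2]; positivity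
  refine (dirichletBottom_le_of_isTestFunction hφ hpos).trans ?_
  rw [div_le_iff₀ hpos, hg2, hφ2]
  nlinarith [mul_le_mul_of_nonneg_right hfR hh0.le, mul_le_mul_of_nonneg_left hhR hf0.le]

end Rectangle

/-! ### Width and inscribed sets of planar convex sets -/

theorem Bornology.IsBounded.image_inner {Ω : Set Plane} (hbdd : Bornology.IsBounded Ω)
    (n : Plane) : Bornology.IsBounded ((fun x : Plane => inner ℝ n x) '' Ω) := by
  obtain ⟨R, hR⟩ := hbdd.exists_norm_le
  refine isBounded_iff_forall_norm_le.mpr ⟨‖n‖ * R, ?_⟩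
  rintro _ ⟨x, hx, rfl⟩
  exact (norm_inner_le_norm n x).trans (mul_le_mul_of_nonneg_left (hR x hx) (norm_nonneg n))

section Width

variable {Ω : Set Plane} (hbdd : Bornology.IsBounded Ω) (hne : Ω.Nonempty)
include hbdd

theorem inner_sub_inner_le_extent (n : Plane) {x y : Plane} (hx : x ∈ Ω) (hy : y ∈ Ω) :
    inner ℝ n x - inner ℝ n y ≤
      sSup ((fun x : Plane => inner ℝ n x) '' Ω) - sInf ((fun x : Plane => inner ℝ n x) '' Ω) :=
  sub_le_sub (le_csSup (hbdd.image_inner n).bddAbove (Set.mem_image_of_mem _ hx))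
    (csInf_le (hbdd.image_inner n).bddBelow (Set.mem_image_of_mem _ hy))

/-- The strict inequality avoids proving that the infimum is attained; later estimates let `W` tend
to the width. -/
theorem exists_strip_of_planarWidth_lt {W : ℝ} (hW : planarWidth Ω < W) :
    ∃ ν : Plane, ‖ν‖ = 1 ∧ ∃ m, ∀ x ∈ Ω, m ≤ inner ℝ ν x ∧ inner ℝ ν x ≤ m + W := by
  have : Nonempty (Metric.sphere (0 : Plane) 1) :=
    (NormedSpace.sphere_nonempty.mpr zero_le_one).to_subtype
  obtain ⟨ν, hν⟩ := exists_lt_of_ciInf_lt hW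
  refine ⟨ν, by simp, sInf ((fun x : Plane => inner ℝ (ν : Plane) x) '' Ω), fun x hx => ⟨?_, ?_⟩⟩
  · exact csInf_le (hbdd.image_inner _).bddBelow (Set.mem_image_of_mem _ hx)
  · have := le_csSup (hbdd.image_inner (ν : Plane)).bddAbove (Set.mem_image_of_mem _ hx)
    linarith

include hne

/-- Homogeneous in `n`, so that separating functionals apply without normalization. -/
theorem planarWidth_le_of_forall_inner_sub_le {n : Plane} (hn : n ≠ 0) {r : ℝ}
    (h : ∀ x ∈ Ω, ∀ y ∈ Ω, inner ℝ n x - inner ℝ n y ≤ r * ‖n‖) : planarWidth Ω ≤ r := by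
  have hn' : 0 < ‖n‖ := norm_pos_iff.mpr hn
  have hbelow : BddBelow (Set.range fun ν : Metric.sphere (0 : Plane) 1 =>
      sSup ((fun x : Plane => inner ℝ (ν : Plane) x) '' Ω) -
        sInf ((fun x : Plane => inner ℝ (ν : Plane) x) '' Ω)) := by
    obtain ⟨x, hx⟩ := hne
    refine ⟨0, ?_⟩
    rintro _ ⟨ν, rfl⟩
    simpa using inner_sub_inner_le_extent hbdd (ν : Plane) hx hx
  refine (ciInf_le hbelow ⟨‖n‖⁻¹ • n, by simp [norm_smul, hn'.ne']⟩).trans ?_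
  rw [sub_le_iff_le_add]
  refine csSup_le (hne.image _) ?_
  rintro _ ⟨x, hx, rfl⟩
  rw [← sub_le_iff_le_add']
  refine le_csInf (hne.image _) ?_
  rintro _ ⟨y, hy, rfl⟩
  have := h x hx y hy
  simp only [real_inner_smul_left]
  have h2 : ‖n‖⁻¹ * (inner ℝ n x - inner ℝ n y) ≤ r := by
    rwa [inv_mul_le_iff₀ hn', mul_comm]
  linarith

theorem planarWidth_le_diam : planarWidth Ω ≤ Metric.diam Ω := by
  obtain ⟨n, hn⟩ := exists_ne (0 : Plane)
  refine planarWidth_le_of_forall_inner_sub_le hbdd hne hn fun x hx y hy => ?_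
  rw [← inner_sub_right, mul_comm]
  refine (real_inner_le_norm n (x - y)).trans (mul_le_mul_of_nonneg_left ?_ (norm_nonneg n))
  rw [← dist_eq_norm]
  exact Metric.dist_le_diam_of_mem hbdd hx hy

theorem planarWidth_pos (hopen : IsOpen Ω) : 0 < planarWidth Ω := by
  obtain ⟨c, hc⟩ := hne
  obtain ⟨r, hr, hball⟩ := Metric.isOpen_iff.mp hopen c hc
  have : Nonempty (Metric.sphere (0 : Plane) 1) :=
    (NormedSpace.sphere_nonempty.mpr zero_le_one).to_subtype
  refine (half_pos hr).trans_le (le_ciInf fun ν => ?_)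
  have hν : ‖(ν : Plane)‖ = 1 := by simp
  have hx : c + (r / 2) • (ν : Plane) ∈ Ω := hball (by
    simp [norm_smul, hν, abs_of_pos hr, hr])
  refine le_trans (le_of_eq ?_) (inner_sub_inner_le_extent hbdd (ν : Plane) hx hc)
  simp [inner_add_right, real_inner_smul_right]

/-- Without such a chord, `Ω` and `Ω + ℓν` are disjoint. A functional `n` separating them varies on
`Ω` by at most `ℓ⟨n, ν⟩ ≤ ℓ‖n‖`, forcing the width to be at most `ℓ`. -/
theorem exists_chord (hopen : IsOpen Ω) (hconv : Convex ℝ Ω) {ν : Plane} (hν : ‖ν‖ = 1) {ℓ : ℝ}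
    (hℓ0 : 0 ≤ ℓ) (hℓ : ℓ < planarWidth Ω) : ∃ q ∈ Ω, q + ℓ • ν ∈ Ω := by
  by_contra! h
  have hdisj : Disjoint Ω ((fun x => ℓ • ν + x) '' Ω) := by
    rw [Set.disjoint_left]
    rintro _ hx ⟨y, hy, rfl⟩
    exact h y hy (by rwa [add_comm])
  obtain ⟨f, u, hf1, hf2⟩ := geometric_hahn_banach_open hconv hopen
    (hconv.translate (ℓ • ν)) hdisj
  set n := (InnerProductSpace.toDual ℝ Plane).symm f with hn
  have hfn : ∀ x, f x = inner ℝ n x := fun x => by rw [hn, InnerProductSpace.toDual_symm_apply]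
  have key : ∀ x ∈ Ω, ∀ y ∈ Ω, inner ℝ n x - inner ℝ n y < ℓ * inner ℝ n ν := fun x hx y hy => by
    have h1 := (hf1 x hx).trans_le (hf2 _ ⟨y, hy, rfl⟩)
    rw [hfn, hfn, inner_add_right, real_inner_smul_right] at h1
    linarith
  have hn0 : n ≠ 0 := by
    rintro h0
    obtain ⟨x, hx⟩ := hne
    simpa [h0] using key x hx x hx
  refine hℓ.not_ge (planarWidth_le_of_forall_inner_sub_le hbdd hne hn0 fun x hx y hy =>
    (key x hx y hy).le.trans (mul_le_mul_of_nonneg_left ?_ hℓ0))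
  simpa [hν] using real_inner_le_norm n ν

/-- The inradius of a planar convex set is at least a third of its width. -/
theorem exists_ball_subset (hopen : IsOpen Ω) (hconv : Convex ℝ Ω) :
    ∃ c, Metric.ball c (planarWidth Ω / 3) ⊆ Ω := by
  classical
  have hK : IsCompact (closure Ω) := hbdd.isCompact_closure
  -- Contract the closure by `2/3` towards each point `x`. By Helly these copies share a point `c`,
  -- which plays the role of a centroid.
  let F : Ω → Set Plane := fun x =>
    (fun z => (1 / 3 : ℝ) • (x : Plane) + (2 / 3 : ℝ) • z) '' closure Ω
  have hF : (⋂ x, F x).Nonempty := by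
    refine Convex.helly_theorem_compact' (𝕜 := ℝ) (fun x => hconv.closure.affinity _ _)
      (fun x => hK.image (by fun_prop)) fun I hI => ?_
    rw [finrank_euclideanSpace_fin] at hI
    rcases I.eq_empty_or_nonempty with rfl | hIne
    · simp
    have hn : (0 : ℝ) < I.card := by exact_mod_cast hIne.card_pos
    have hn3 : (I.card : ℝ) ≤ 3 := by exact_mod_cast hI
    -- The centroid of at most three points works: solving for the preimage under the contraction at
    -- `i` gives nonnegative weights because `|I| ≤ 3`.
    refine ⟨(1 / I.card : ℝ) • ∑ j ∈ I, (j : Plane), Set.mem_iInter₂.mpr fun i hi => ?_⟩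
    refine ⟨∑ j ∈ I, ((3 / I.card - if j = i then 1 else 0) / 2 : ℝ) • (j : Plane), ?_, ?_⟩
    · refine hconv.closure.sum_mem (fun j _ => ?_) ?_ fun j _ => subset_closure j.2
      · have : 1 ≤ 3 / (I.card : ℝ) := by rwa [one_le_div hn]
        split_ifs <;> linarith
      · rw [← Finset.sum_div, Finset.sum_sub_distrib, Finset.sum_ite_eq' I i, if_pos hi,
          Finset.sum_const, nsmul_eq_mul, mul_div_cancel₀ _ hn.ne']
        norm_num
    · have : ∑ j ∈ I, ((3 / I.card - if j = i then 1 else 0) / 2 : ℝ) • (j : Plane) =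
          (3 / 2 : ℝ) • (1 / I.card : ℝ) • (∑ j ∈ I, (j : Plane)) - (1 / 2 : ℝ) • (i : Plane) := by
        have hi' : (1 / 2 : ℝ) • (i : Plane) =
            ∑ j ∈ I, if j = i then (1 / 2 : ℝ) • (j : Plane) else 0 := by
          rw [Finset.sum_ite_eq' I i, if_pos hi]
        rw [Finset.smul_sum, Finset.smul_sum, hi', ← Finset.sum_sub_distrib]
        refine Finset.sum_congr rfl fun j _ => ?_
        split_ifs <;> module
      simp only [this]
      module
  obtain ⟨c, hc⟩ := hF
  refine ⟨c, fun y hy => ?_⟩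
  by_contra hyΩ
  obtain ⟨f, hf⟩ := geometric_hahn_banach_open_point hconv hopen hyΩ
  set n := (InnerProductSpace.toDual ℝ Plane).symm f with hn
  have hfn : ∀ x, f x = inner ℝ n x := fun x => by rw [hn, InnerProductSpace.toDual_symm_apply]
  have hcl : ∀ z ∈ closure Ω, f z ≤ f y := fun z hz =>
    closure_minimal (fun x hx => (hf x hx).le) (isClosed_le f.continuous continuous_const) hz
  -- From `c = x/3 + 2z/3` and `f z ≤ f y`. Thus `f` varies on `Ω` by at most `3 (f y - f c)`, so
  -- the width is at most `3‖y - c‖`.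
  have hlow : ∀ x ∈ Ω, 3 * f c - 2 * f y ≤ f x := fun x hx => by
    obtain ⟨z, hz, hzc⟩ := Set.mem_iInter.mp hc ⟨x, hx⟩
    have h1 := hcl z hz
    rw [← hzc]
    simp only [map_add, map_smul, smul_eq_mul]
    linarith
  have hn0 : n ≠ 0 := by
    rintro h0
    obtain ⟨x, hx⟩ := hne
    simpa [hfn, h0] using hf x hx
  have := planarWidth_le_of_forall_inner_sub_le hbdd hne hn0 (r := 3 * ‖y - c‖)
    fun x hx x' hx' => by
      have h1 := hf x hx
      have h2 := hlow x' hx'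
      have h3 := real_inner_le_norm n (y - c)
      rw [inner_sub_right] at h3
      rw [hfn, hfn] at h1
      rw [hfn, hfn, hfn] at h2
      linarith
  rw [mem_ball_iff_norm] at hy
  linarith

end Width

/-! ### Orthonormal coordinates and eigenvalue bounds from inscribed rectangles -/

theorem norm_sq_eq_inner_sq_add_inner_sq {e ν : Plane} (he : ‖e‖ = 1) (hν : ‖ν‖ = 1)
    (heν : inner ℝ e ν = 0) (x : Plane) : ‖x‖ ^ 2 = inner ℝ e x ^ 2 + inner ℝ ν x ^ 2 := by
  obtain ⟨b, rfl, rfl⟩ := exists_orthonormalBasis_of_inner_eq_zero he hν heν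
  rw [← b.sum_sq_norm_inner_right x, Fin.sum_univ_two]
  simp

theorem eq_inner_smul_add_inner_smul {e ν : Plane} (he : ‖e‖ = 1) (hν : ‖ν‖ = 1)
    (heν : inner ℝ e ν = 0) (x : Plane) : x = inner ℝ e x • e + inner ℝ ν x • ν := by
  obtain ⟨b, rfl, rfl⟩ := exists_orthonormalBasis_of_inner_eq_zero he hν heν
  conv_lhs => rw [← b.sum_repr' x, Fin.sum_univ_two]

theorem exists_norm_eq_one_inner_eq_zero {ν : Plane} (hν : ‖ν‖ = 1) :
    ∃ e : Plane, ‖e‖ = 1 ∧ inner ℝ e ν = 0 := by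
  refine ⟨!₂[-ν 1, ν 0], ?_, ?_⟩
  · rw [← hν, EuclideanSpace.norm_eq, EuclideanSpace.norm_eq]
    simp [Fin.sum_univ_two, add_comm]
  · simp [PiLp.inner_apply, Fin.sum_univ_two]
    ring

/-- The disc contains an open square of side `√2 r`. This crude bound is enough when the set is not
thin. -/
theorem dirichletBottom_le_of_ball_subset {Ω : Set Plane} (hbdd : Bornology.IsBounded Ω)
    {c : Plane} {r : ℝ} (hr : 0 < r) (hball : Metric.ball c r ⊆ Ω) :
    dirichletBottom Ω ≤ Real.pi ^ 2 / r ^ 2 := by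
  have hν : ‖(EuclideanSpace.single 0 1 : Plane)‖ = 1 := by simp
  obtain ⟨e, he, heν⟩ := exists_norm_eq_one_inner_eq_zero hν
  set ν : Plane := EuclideanSpace.single 0 1
  set a := √2 * r with ha
  have ha0 : 0 < a := by positivity
  have ha2 : a ^ 2 = 2 * r ^ 2 := by rw [ha, mul_pow, Real.sq_sqrt zero_le_two]
  refine (dirichletBottom_le_of_rectangle_subset hbdd he hν heν (α := inner ℝ e c - a / 2)
    (β := inner ℝ ν c - a / 2) ha0 ha0 fun x h1 h2 => hball ?_).trans (le_of_eq ?_)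
  · rw [mem_ball_iff_norm]
    refine lt_of_pow_lt_pow_left₀ 2 hr.le ?_
    rw [norm_sq_eq_inner_sq_add_inner_sq he hν heν, inner_sub_right, inner_sub_right]
    obtain ⟨h3, h4⟩ := h1
    obtain ⟨h5, h6⟩ := h2
    nlinarith
  · rw [ha2]
    field_simp
    norm_num

/-- A thin triangle, with its base across a strip containing the set, contains a rectangle. -/
theorem dirichletBottom_le_of_chord {Ω : Set Plane} (hbdd : Bornology.IsBounded Ω)
    (hconv : Convex ℝ Ω) {e ν : Plane} (he : ‖e‖ = 1) (hν : ‖ν‖ = 1) (heν : inner ℝ e ν = 0)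
    {m W : ℝ} (hstrip : ∀ x ∈ Ω, m ≤ inner ℝ ν x ∧ inner ℝ ν x ≤ m + W) {ℓ L s : ℝ} {p q : Plane}
    (hq : q ∈ Ω) (hqℓ : q + ℓ • ν ∈ Ω) (hp : p ∈ Ω) (hℓ : 0 < ℓ) (hL : 0 < L) (hs : 0 < s)
    (hsW : s * W < ℓ) (hpL : L ≤ inner ℝ e (p - q)) :
    dirichletBottom Ω ≤ Real.pi ^ 2 / (s * L) ^ 2 + Real.pi ^ 2 / (ℓ - s * W) ^ 2 := by
  have hνν : inner ℝ ν ν = 1 := by rw [real_inner_self_eq_norm_sq, hν, one_pow]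
  set L' := inner ℝ e (p - q) with hL'
  have hL'0 : 0 < L' := hL.trans_le hpL
  set c := inner ℝ ν (p - q) with hc
  set A := max c 0 with hA
  set B := max (ℓ - c) 0 with hB
  have hpq : p = q + (L' • e + c • ν) := by
    rw [hL', hc, ← eq_inner_smul_add_inner_smul he hν heν]
    abel
  -- `A` and `B` bound the rise of the lower edge and the fall of the upper edge from base to apex.
  -- Their sum is the triangle's extent along `ν`, so stopping at fraction `s` loses at most `sW` of
  -- height.
  have hAB : A + B ≤ W := by
    have h1 := hstrip q hq
    have h2 := hstrip _ hqℓ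
    have h3 := hstrip p hp
    rw [inner_add_right, real_inner_smul_right, hνν] at h2
    have h4 : c = inner ℝ ν p - inner ℝ ν q := inner_sub_right _ _ _
    rcases max_cases c 0 with ⟨h5, h6⟩ | ⟨h5, h6⟩ <;>
      rcases max_cases (ℓ - c) 0 with ⟨h7, h8⟩ | ⟨h7, h8⟩ <;> rw [hA, hB, h5, h7] <;> linarith
  have hlen : 0 < ℓ - s * W := by linarith
  refine (dirichletBottom_le_of_rectangle_subset hbdd he hν heν (α := inner ℝ e q)
    (β := inner ℝ ν q + s * A) (a := s * L') (b := ℓ - s * W) (by positivity) hlen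
    fun x h1 h2 => ?_).trans ?_
  · set t := (inner ℝ e x - inner ℝ e q) / L' with ht
    set y := inner ℝ ν x - inner ℝ ν q with hy
    have hx : x = q + ((t * L') • e + y • ν) := by
      rw [ht, hy, div_mul_cancel₀ _ hL'0.ne', ← inner_sub_right, ← inner_sub_right,
        ← eq_inner_smul_add_inner_smul he hν heν]
      abel
    have ht0 : 0 ≤ t := div_nonneg (by linarith [h1.1]) hL'0.le
    have hts : t ≤ s := by rw [ht, div_le_iff₀ hL'0]; linarith [h1.2]
    have hy1 : t * c ≤ y := by
      have : t * c ≤ s * A := (mul_le_mul_of_nonneg_left (le_max_left c 0) ht0).trans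
        (mul_le_mul_of_nonneg_right hts (le_max_right c 0))
      linarith [h2.1]
    have hy2 : y ≤ ℓ - t * (ℓ - c) := by
      have h3 : t * (ℓ - c) ≤ s * B := (mul_le_mul_of_nonneg_left (le_max_left (ℓ - c) 0) ht0).trans
        (mul_le_mul_of_nonneg_right hts (le_max_right (ℓ - c) 0))
      have h4 := mul_le_mul_of_nonneg_left hAB hs.le
      linarith [h2.2]
    -- Barycentric coordinates in the triangle; `hy1` and `hy2` make them nonnegative.
    have hcomb : x = (1 - (y - t * c) / ℓ - t) • q + ((y - t * c) / ℓ) • (q + ℓ • ν) + t • p := by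
      rw [hx, hpq]
      have : y = (y - t * c) / ℓ * ℓ + t * c := by field_simp; ring
      generalize (y - t * c) / ℓ = z at this
      rw [this]
      module
    have hz0 : 0 ≤ (y - t * c) / ℓ := div_nonneg (by linarith) hℓ.le
    have hz1 : (y - t * c) / ℓ ≤ 1 - t := by rw [div_le_iff₀ hℓ]; linarith
    rw [hcomb]
    have := hconv.sum_mem (t := Finset.univ)
      (w := ![1 - (y - t * c) / ℓ - t, (y - t * c) / ℓ, t]) (z := ![q, q + ℓ • ν, p])
      (by intro i _; fin_cases i <;> simp <;> linarith)
      (by simp only [Fin.sum_univ_three, Matrix.cons_val]; ring)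
      (by intro i _; fin_cases i <;> simp [hq, hqℓ, hp])
    simpa [Fin.sum_univ_three] using this
  · gcongr

/-- Two points more than `d` apart in a strip of width `W` differ by at least `√(d² - W²)` along it,
so one of them is at least half that far from the chord; the half gives the factor `4`. -/
theorem dirichletBottom_le_of_lt {Ω : Set Plane} (hopen : IsOpen Ω)
    (hbdd : Bornology.IsBounded Ω) (hne : Ω.Nonempty) (hconv : Convex ℝ Ω) {W ℓ d s : ℝ}
    (hW : planarWidth Ω < W) (hℓ : 0 < ℓ) (hℓw : ℓ < planarWidth Ω) (hd : d < Metric.diam Ω)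
    (hWd : W < d) (hs : 0 < s) (hsW : s * W < ℓ) :
    dirichletBottom Ω ≤
      4 * Real.pi ^ 2 / (s ^ 2 * (d ^ 2 - W ^ 2)) + Real.pi ^ 2 / (ℓ - s * W) ^ 2 := by
  obtain ⟨ν, hν, m, hstrip⟩ := exists_strip_of_planarWidth_lt hbdd hW
  obtain ⟨e, he, heν⟩ := exists_norm_eq_one_inner_eq_zero hν
  obtain ⟨q, hq, hqℓ⟩ := exists_chord hbdd hne hopen hconv hν hℓ.le hℓw
  have hW0 : 0 < W := by linarith
  obtain ⟨p₁, hp₁, p₂, hp₂, hdist⟩ : ∃ p₁ ∈ Ω, ∃ p₂ ∈ Ω, d < dist p₁ p₂ := by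
    by_contra! h
    exact hd.not_ge (Metric.diam_le_of_forall_dist_le (by linarith) h)
  have hH : 0 < d ^ 2 - W ^ 2 := by nlinarith
  set H := √(d ^ 2 - W ^ 2) with hHdef
  have hH0 : 0 < H := Real.sqrt_pos.mpr hH
  have hHsq : H ^ 2 = d ^ 2 - W ^ 2 := Real.sq_sqrt hH.le
  have hfar : H ≤ |inner ℝ e (p₁ - p₂)| := by
    refine le_of_sq_le_sq ?_ (abs_nonneg _)
    have h1 := norm_sq_eq_inner_sq_add_inner_sq he hν heν (p₁ - p₂)
    rw [dist_eq_norm] at hdist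
    have h2 : inner ℝ ν (p₁ - p₂) ^ 2 ≤ W ^ 2 := by
      have h3 := hstrip p₁ hp₁
      have h4 := hstrip p₂ hp₂
      rw [inner_sub_right]
      exact sq_le_sq' (by linarith) (by linarith)
    rw [sq_abs, hHsq]
    nlinarith
  have hex : ∃ p ∈ Ω, H / 2 ≤ |inner ℝ e (p - q)| := by
    by_contra! h
    have h1 := h p₁ hp₁
    have h2 := h p₂ hp₂
    have h3 := abs_sub (inner ℝ e (p₁ - q)) (inner ℝ e (p₂ - q))
    rw [← inner_sub_right, sub_sub_sub_cancel_right] at h3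
    linarith
  obtain ⟨p, hp, hpH⟩ := hex
  have key : dirichletBottom Ω ≤
      Real.pi ^ 2 / (s * (H / 2)) ^ 2 + Real.pi ^ 2 / (ℓ - s * W) ^ 2 := by
    rcases le_abs.mp hpH with h | h
    · exact dirichletBottom_le_of_chord hbdd hconv he hν heν hstrip hq hqℓ hp hℓ (half_pos hH0) hs
        hsW h
    · refine dirichletBottom_le_of_chord hbdd hconv (e := -e) (by rwa [norm_neg]) hν
        (by rw [inner_neg_left, heν, neg_zero]) hstrip hq hqℓ hp hℓ (half_pos hH0) hs hsW ?_
      rwa [inner_neg_left]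
  refine key.trans (le_of_eq ?_)
  rw [mul_pow, div_pow, hHsq]
  congr 1
  field_simp
  norm_num

theorem dirichletBottom_le_of_planarWidth_lt_diam {Ω : Set Plane} (hopen : IsOpen Ω)
    (hbdd : Bornology.IsBounded Ω) (hne : Ω.Nonempty) (hconv : Convex ℝ Ω) {s : ℝ}
    (hd : planarWidth Ω < Metric.diam Ω) (hs : 0 < s) (hs1 : s < 1) :
    dirichletBottom Ω ≤ 4 * Real.pi ^ 2 / (s ^ 2 * (Metric.diam Ω ^ 2 - planarWidth Ω ^ 2)) +
      Real.pi ^ 2 / (planarWidth Ω - s * planarWidth Ω) ^ 2 := by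
  have hw := planarWidth_pos hbdd hne hopen
  set w := planarWidth Ω with hwdef
  set d := Metric.diam Ω with hddef
  have h1 : s ^ 2 * (d ^ 2 - w ^ 2) ≠ 0 :=
    mul_ne_zero (by positivity) (by nlinarith : 0 < d ^ 2 - w ^ 2).ne'
  have h2 : (w - s * w) ^ 2 ≠ 0 := pow_ne_zero _ (by nlinarith : 0 < w - s * w).ne'
  have hcont : ContinuousAt (fun δ : ℝ => 4 * Real.pi ^ 2 /
      (s ^ 2 * ((d - δ) ^ 2 - (w + δ) ^ 2)) + Real.pi ^ 2 / (w - δ - s * (w + δ)) ^ 2) 0 := by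
    refine ContinuousAt.add (ContinuousAt.div (by fun_prop) (by fun_prop) (by simpa using h1))
      (ContinuousAt.div (by fun_prop) (by fun_prop) (by simpa using h2))
  have hlim := hcont.tendsto.mono_left (nhdsWithin_le_nhds (s := Set.Ioi 0))
  simp only [sub_zero, add_zero] at hlim
  refine ge_of_tendsto hlim ?_
  have e1 : ∀ᶠ δ : ℝ in 𝓝[>] 0, δ < w := nhdsWithin_le_nhds (eventually_lt_nhds hw)
  have e2 : ∀ᶠ δ : ℝ in 𝓝[>] 0, w + δ < d - δ := nhdsWithin_le_nhds
    ((by fun_prop : ContinuousAt (fun δ : ℝ => w + δ) 0).eventually_lt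
      (by fun_prop : ContinuousAt (fun δ : ℝ => d - δ) 0) (by simpa using hd))
  have e3 : ∀ᶠ δ : ℝ in 𝓝[>] 0, s * (w + δ) < w - δ := nhdsWithin_le_nhds
    ((by fun_prop : ContinuousAt (fun δ : ℝ => s * (w + δ)) 0).eventually_lt
      (by fun_prop : ContinuousAt (fun δ : ℝ => w - δ) 0) (by simp; nlinarith))
  filter_upwards [e1, e2, e3, self_mem_nhdsWithin] with δ a1 a2 a3 (a4 : 0 < δ)
  exact dirichletBottom_le_of_lt hopen hbdd hne hconv (by linarith) (by linarith) (by linarith)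
    (by linarith) a2 hs a3

/-- For thin sets take `s = τ`; since `τ³ = (w / d)²`, everything becomes a function of `τ` alone.
-/
theorem dirichletBottom_mul_planarWidth_sq_le {Ω : Set Plane} (hopen : IsOpen Ω)
    (hbdd : Bornology.IsBounded Ω) (hne : Ω.Nonempty) (hconv : Convex ℝ Ω) :
    dirichletBottom Ω * planarWidth Ω ^ 2 ≤
      Real.pi ^ 2 * (1 + 14 * (planarWidth Ω / Metric.diam Ω) ^ ((2 : ℝ) / 3)) := by
  have hw := planarWidth_pos hbdd hne hopen
  have hd0 : 0 ≤ Metric.diam Ω := Metric.diam_nonneg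
  set w := planarWidth Ω with hwdef
  set d := Metric.diam Ω with hddef
  set τ := (w / d) ^ ((2 : ℝ) / 3) with hτdef
  have hτ3 : τ ^ 3 = (w / d) ^ 2 := by
    rw [hτdef, ← Real.rpow_natCast, ← Real.rpow_mul (by positivity)]
    norm_num
  -- At `τ = 4/7` the target `1 + 14 τ` equals `9`, the constant given by the inradius bound.
  rcases le_total (4 / 7) τ with h | h
  · obtain ⟨c, hc⟩ := exists_ball_subset hbdd hne hopen hconv
    have h1 := dirichletBottom_le_of_ball_subset hbdd (by positivity) hc
    rw [div_pow, div_div_eq_mul_div, le_div_iff₀ (by positivity)] at h1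
    nlinarith [Real.pi_pos, sq_nonneg Real.pi]
  · have hd : 0 < d := hw.trans_le (planarWidth_le_diam hbdd hne)
    have hτ0 : 0 < τ := Real.rpow_pos_of_pos (by positivity) _
    have hτ31 : τ ^ 3 ≤ 1 / 5 := (pow_le_pow_left₀ hτ0.le h 3).trans (by norm_num)
    have hd2 : τ ^ 3 * d ^ 2 = w ^ 2 := by rw [hτ3]; field_simp
    have hwd : w < d := by
      refine lt_of_pow_lt_pow_left₀ 2 hd.le ?_
      nlinarith [pow_pos hd 2]
    have h1 := dirichletBottom_le_of_planarWidth_lt_diam hopen hbdd hne hconv hwd hτ0 (by linarith)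
    have hone : 0 < 1 - τ := by linarith
    have hone3 : 0 < 1 - τ ^ 3 := by linarith
    have h2 : (4 * Real.pi ^ 2 / (τ ^ 2 * (d ^ 2 - w ^ 2)) + Real.pi ^ 2 / (w - τ * w) ^ 2) * w ^ 2 =
        Real.pi ^ 2 * (4 * τ / (1 - τ ^ 3) + 1 / (1 - τ) ^ 2) := by
      rw [show w - τ * w = (1 - τ) * w by ring, ← hd2,
        show d ^ 2 - τ ^ 3 * d ^ 2 = (1 - τ ^ 3) * d ^ 2 by ring, mul_pow, ← hd2]
      field_simp
    refine (mul_le_mul_of_nonneg_right h1 (by positivity)).trans ?_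
    rw [h2]
    refine mul_le_mul_of_nonneg_left ?_ (by positivity)
    -- The constant `14` is `5 + 9`: here `τ³ ≤ 1/5`, and in `h4` the quadratic `7 - 17τ + 9τ²` is
    -- still positive at `4/7`.
    have h3 : 4 * τ / (1 - τ ^ 3) ≤ 5 * τ := by
      rw [div_le_iff₀ hone3]
      nlinarith
    have h4 : 1 / (1 - τ) ^ 2 ≤ 1 + 9 * τ := by
      rw [div_le_iff₀ (by positivity)]
      have : 0 ≤ τ * (7 - 17 * τ + 9 * τ ^ 2) := mul_nonneg hτ0.le (by nlinarith)
      nlinarith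
    linarith

/-! ### Sup bound for the torsion function and conclusion -/

theorem IsTorsionFunction.memLp_top_and_toReal_eLpNorm_le {Ω : Set Plane} (hopen : IsOpen Ω)
    (hbdd : Bornology.IsBounded Ω) (hne : Ω.Nonempty) {v : Plane → ℝ}
    (hv : IsTorsionFunction Ω v) :
    MemLp v ∞ (volume.restrict Ω) ∧
      (eLpNorm v ∞ (volume.restrict Ω)).toReal ≤ planarWidth Ω ^ 2 / 8 := by
  have hw := planarWidth_pos hbdd hne hopen
  have hm : AEStronglyMeasurable v (volume.restrict Ω) := by
    obtain ⟨g, hg, -⟩ := hv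
    exact hg.memLp.aestronglyMeasurable
  have key : ∀ W, planarWidth Ω < W →
      eLpNorm v ∞ (volume.restrict Ω) ≤ ENNReal.ofReal (W ^ 2 / 8) := fun W hW => by
    obtain ⟨ν, hν, m, hstrip⟩ := exists_strip_of_planarWidth_lt hbdd hW
    rw [eLpNorm_exponent_top]
    refine eLpNormEssSup_le_of_ae_bound ?_
    filter_upwards [hv.ae_mem_Icc hopen hbdd hν hstrip] with x hx
    rw [Real.norm_of_nonneg hx.1]
    exact hx.2
  refine ⟨⟨hm, (key _ (lt_add_one _)).trans_lt ENNReal.ofReal_lt_top⟩, ?_⟩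
  have hlim : Tendsto (fun W : ℝ => W ^ 2 / 8) (𝓝[>] (planarWidth Ω))
      (𝓝 (planarWidth Ω ^ 2 / 8)) :=
    ((continuous_pow 2).div_const 8).continuousAt.tendsto.mono_left nhdsWithin_le_nhds
  refine ge_of_tendsto hlim ?_
  filter_upwards [self_mem_nhdsWithin] with W hW
  exact ENNReal.toReal_le_of_le_ofReal (by positivity) (key W hW)

theorem theorem1p2 (Ω : Set Plane) (hopen : IsOpen Ω) (hconv : Convex ℝ Ω)
    (hbdd : Bornology.IsBounded Ω) (hne : Ω.Nonempty) :
    (∃ v : Plane → ℝ, IsTorsionFunction Ω v) ∧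
    ∀ v : Plane → ℝ, IsTorsionFunction Ω v →
      MemLp v ∞ (volume.restrict Ω) ∧
      (eLpNorm v ∞ (volume.restrict Ω)).toReal * dirichletBottom Ω ≤
        Real.pi ^ 2 / 8 *
          (1 + 7 * (3 : ℝ) ^ ((2 : ℝ) / 3) *
            (planarWidth Ω / Metric.diam Ω) ^ ((2 : ℝ) / 3)) := by
  refine ⟨exists_isTorsionFunction hopen hbdd, fun v hv => ?_⟩
  obtain ⟨hmem, hnorm⟩ := hv.memLp_top_and_toReal_eLpNorm_le hopen hbdd hne
  refine ⟨hmem, ?_⟩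
  have hρ : 0 ≤ (planarWidth Ω / Metric.diam Ω) ^ ((2 : ℝ) / 3) :=
    Real.rpow_nonneg (div_nonneg (planarWidth_pos hbdd hne hopen).le Metric.diam_nonneg) _
  -- Cubing reduces this to `8 ≤ 9`.
  have h3 : (2 : ℝ) ≤ (3 : ℝ) ^ ((2 : ℝ) / 3) := by
    refine le_of_pow_le_pow_left₀ three_ne_zero (by positivity) ?_
    rw [← Real.rpow_natCast ((3 : ℝ) ^ _), ← Real.rpow_mul (by norm_num)]
    norm_num
  have hlam := dirichletBottom_mul_planarWidth_sq_le hopen hbdd hne hconv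
  calc (eLpNorm v ∞ (volume.restrict Ω)).toReal * dirichletBottom Ω
      ≤ planarWidth Ω ^ 2 / 8 * dirichletBottom Ω :=
        mul_le_mul_of_nonneg_right hnorm (dirichletBottom_nonneg Ω)
    _ = dirichletBottom Ω * planarWidth Ω ^ 2 / 8 := by ring
    _ ≤ Real.pi ^ 2 * (1 + 14 * (planarWidth Ω / Metric.diam Ω) ^ ((2 : ℝ) / 3)) / 8 := by
        gcongr
    _ = Real.pi ^ 2 / 8 * (1 + 7 * 2 * (planarWidth Ω / Metric.diam Ω) ^ ((2 : ℝ) / 3)) := by ring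
    _ ≤ _ := by gcongr
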